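/- Let $a_1,a_2,a_3,c$ be pairwise distinct complex numbers, $U_4(\lambda)=-(\lambda-a_1)(\lambda-a_2)(\lambda-a_3)(\lambda-c)$ and $E=\{\mu^2=U_4(\lambda)\}$. All paths below are $C^1$ paths in the finite part of $E$ that start at $(c,0)$, and $$u=\mathrm i\int_{(c,0)}^{(\lambda,\mu)}\frac{d\lambda}{2\mu}$$ is the Abel map along such a path. Let $\sigma$, $\zeta=\sigma'/\sigma$, $\wp$ be the Weierstrass functions with invariants $g_2=-4(e_1e_2+e_2e_3+e_3e_1)$, $g_3=4e_1e_2e_3$, where $3e_\alpha=\tau_2+c\tau_1-3(a_\beta a_\gamma+ca_\alpha)$ for $\{\alpha,\beta,\gamma\}=\{1,2,3\}$, $\tau_1=a_1+a_2+a_3$, $\tau_2=a_1a_2+a_2a_3+a_3a_1$ (so that $w^2=4(z-e_1)(z-e_2)(z-e_3)$ is the Weierstrass form of $E$ obtained by sending $\lambda=c$ to infinity). Let $k$ be an odd positive integer, $K$ a polynomial of degree at most $k$, $Q(\lambda)=r_0(\lambda-r_1)\cdots(\lambda-r_k)$ with $r_0\neq0$ and $r_1,\dots,r_k$ distinct, and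 suppose that $$W=\frac{K(\lambda)}{Q(\lambda)}\,\frac{d\lambda}{2\mu}$$ has simple poles at the points $\mathcal P_j^{\pm}=(r_j,\pm\mu_j)\in E$, $j=1,\dots,k$, with residues $\pm1$ respectively. Let $w_j=\mathrm i\int_{(c,0)}^{\mathcal P_j^{+}}\frac{d\lambda}{2\mu}$, along any path. Then: 0. The lattice of $\sigma,\zeta,\wp$ is the period lattice of $E$, that is, the set of all values of $\mathrm i\oint d\lambda/(2\mu)$ over closed paths; the integral $u$ converges along every path. 1. For every path from $(c,0)$ to $(\lambda,\mu)$ that avoids the poles of $W$, both integrals being taken along this path, $$\int_{(c,0)}^{(\lambda,\mu)}W=\log\frac{\sigma(u-w_1)\cdots\sigma(u-w_k)}{\sigma(u+w_1)\cdots\sigma(u+w_k)}+2\,[\zeta(w_1)+\cdots+\zeta(w_k)]\,u+\delta\,u-\pi\mathrm i,\qquad \delta=-\mathrm i\,\frac{K(c)}{Q(c)},$$ where the logarithm is continued along the path from the value $\log(-1)=\pi\mathrm i$ at $u=0$. 2. There is a constant $A\ne0$, independent of the path, such that $$\frac{\sqrt{(\lambda-r_1)\cdots(\lambda-r_k)}}{\sqrt{(\lambda-c)^k}}=\pm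 A\,\frac{\sqrt{\sigma(u-w_1)\cdots\sigma(u-w_k)\,\sigma(u+w_1)\cdots\sigma(u+w_k)}}{\sigma^k(u)}.$$ That is, the squares of both sides agree at all points of every path with $\lambda\neq c$; and for any continuous branches of the three square roots along a connected piece of a path on which $\lambda\ne c,r_1,\dots,r_k$, the equality holds with one and the same sign on the whole piece. 3. The signs of the $w_j$ are determined by $$\frac{K(r_j)}{(r_j-c)^2\,Q'(r_j)}=\frac{\mathrm i}{(a_1-c)(a_2-c)(a_3-c)}\,\wp'(w_j):$$ if $v$ is a value of the Abel map at a point $p\in E$ over $\lambda=r_j$, then this relation holds with $v$ in place of $w_j$ if and only if $p=\mathcal P_j^{+}$. -/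

import Mathlib

open Set Filter Topology MeasureTheory Polynomial

noncomputable section

/-- The data of the degree four curve `E : μ² = -(λ - a₁)(λ - a₂)(λ - a₃)(λ - c)` with four
distinct branch points. -/
structure QuarticCurve where
  a₁ : ℂ
  a₂ : ℂ
  a₃ : ℂ
  c : ℂ
  ne₁₂ : a₁ ≠ a₂
  ne₁₃ : a₁ ≠ a₃
  ne₂₃ : a₂ ≠ a₃
  c_ne₁ : c ≠ a₁
  c_ne₂ : c ≠ a₂
  c_ne₃ : c ≠ a₃

namespace QuarticCurve

variable (E : QuarticCurve)

/-- The polynomial `U₄(x) = -(x - a₁)(x - a₂)(x - a₃)(x - c)`. -/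
def U₄ (x : ℂ) : ℂ := -((x - E.a₁) * (x - E.a₂) * (x - E.a₃) * (x - E.c))

/-- The finite points `(λ, μ)` of the curve. -/
def points : Set (ℂ × ℂ) := {p | p.2 ^ 2 = E.U₄ p.1}

/-- The branch points `e₁, e₂, e₃` of the Weierstrass form of the curve (the transformation to the
Weierstrass form sends `λ = c` to infinity and `aᵢ` to `eᵢ`); they satisfy `e₁ + e₂ + e₃ = 0`. -/
def e₁ : ℂ := (E.a₁ * E.a₂ + E.a₂ * E.a₃ + E.a₃ * E.a₁ + E.c * (E.a₁ + E.a₂ + E.a₃)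
  - 3 * (E.a₂ * E.a₃ + E.c * E.a₁)) / 3

/-- The branch point `e₂` of the Weierstrass form, the image of `a₂`. -/
def e₂ : ℂ := (E.a₁ * E.a₂ + E.a₂ * E.a₃ + E.a₃ * E.a₁ + E.c * (E.a₁ + E.a₂ + E.a₃)
  - 3 * (E.a₃ * E.a₁ + E.c * E.a₂)) / 3

/-- The branch point `e₃` of the Weierstrass form, the image of `a₃`. -/
def e₃ : ℂ := (E.a₁ * E.a₂ + E.a₂ * E.a₃ + E.a₃ * E.a₁ + E.c * (E.a₁ + E.a₂ + E.a₃)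
  - 3 * (E.a₁ * E.a₂ + E.c * E.a₃)) / 3

/-- The invariant `g₂` of the Weierstrass form
`w² = 4 (z - e₁)(z - e₂)(z - e₃) = 4 z³ - g₂ z - g₃`. -/
def g₂ : ℂ := -4 * (E.e₁ * E.e₂ + E.e₂ * E.e₃ + E.e₃ * E.e₁)

/-- The invariant `g₃` of the Weierstrass form
`w² = 4 (z - e₁)(z - e₂)(z - e₃) = 4 z³ - g₂ z - g₃`. -/
def g₃ : ℂ := 4 * E.e₁ * E.e₂ * E.e₃

/-- A `C¹` path `t ↦ (λ(t), μ(t))`, `0 ≤ t ≤ 1`, in the finite part of the curve, which starts at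
the branch point `(c, 0)`. -/
structure Path where
  lam : ℝ → ℂ
  mu : ℝ → ℂ
  contDiffOn_lam : ContDiffOn ℝ 1 lam (Icc 0 1)
  contDiffOn_mu : ContDiffOn ℝ 1 mu (Icc 0 1)
  mem_points : ∀ t ∈ Icc (0 : ℝ) 1, (lam t, mu t) ∈ E.points
  lam_zero : lam 0 = E.c
  mu_zero : mu 0 = 0

namespace Path

variable {E} (γ : E.Path)

/-- The end point of the path. -/
def endpoint : ℂ × ℂ := (γ.lam 1, γ.mu 1)

/-- The pull-back to the parameter interval of the differential `R(λ) dλ / (2 μ)`. (As `λ` and `μ`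
are both `C¹` and all zeros of `U₄` are simple, `λ' = 0` wherever `μ = 0`, and the set of parameters
with `μ = 0` and `μ' ≠ 0` is countable, so that the value of the quotient at `μ = 0` plays no role
for the integral.) -/
def pullback (R : ℂ → ℂ) (t : ℝ) : ℂ := R (γ.lam t) * (deriv γ.lam t / (2 * γ.mu t))

/-- The integral of the differential `R(λ) dλ / (2 μ)` along the path from the parameter `0` to the
parameter `t`. -/
def integral (R : ℂ → ℂ) (t : ℝ) : ℂ := ∫ s in (0 : ℝ)..t, γ.pullback R s

/-- The Abel map `u = i ∫ dλ / (2 μ)` along the path from the parameter `0` to `t`. -/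
def abel (t : ℝ) : ℂ := Complex.I * γ.integral (fun _ => 1) t

end Path

/-- `u` is a value of the (multivalued) Abel map `p ↦ i ∫_{(c, 0)}^p dλ / (2 μ)` at `p`. -/
def IsAbelImage (p : ℂ × ℂ) (u : ℂ) : Prop := ∃ γ : E.Path, γ.endpoint = p ∧ γ.abel 1 = u

/-- The differential `f(λ, μ) dλ` on the curve has a simple pole with residue `ρ ≠ 0` at the
point `p`, which is not a branch point, so that `λ` is a local coordinate at `p`. -/
def HasSimplePoleResidue (f : ℂ × ℂ → ℂ) (p : ℂ × ℂ) (ρ : ℂ) : Prop :=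
  p ∈ E.points ∧ p.2 ≠ 0 ∧ ρ ≠ 0 ∧
    Tendsto (fun q : ℂ × ℂ => (q.1 - p.1) * f q) (𝓝[E.points \ {p}] p) (𝓝 ρ)

end QuarticCurve

/-- The Weierstrass sigma function of a lattice. -/
def weierstrassSigma (L : PeriodPair) (z : ℂ) : ℂ :=
  z * ∏' l : {l : L.lattice // l ≠ 0},
    (1 - z / (l.1 : ℂ)) * Complex.exp (z / (l.1 : ℂ) + (z / (l.1 : ℂ)) ^ 2 / 2)

/-- The Weierstrass zeta function `ζ = σ' / σ` of a lattice. -/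
def weierstrassZeta (L : PeriodPair) (z : ℂ) : ℂ :=
  deriv (weierstrassSigma L) z / weierstrassSigma L z

end

noncomputable section

/-! ### The Weierstrass sigma function -/

/-- The canonical factor of the sigma function at the lattice point `l`; it is `1` for `l = 0`. -/
def sigmaFactor (l z : ℂ) : ℂ := (1 - z / l) * Complex.exp (z / l + (z / l) ^ 2 / 2)

@[simp] lemma sigmaFactor_zero_left (z : ℂ) : sigmaFactor 0 z = 1 := by simp [sigmaFactor]

@[simp] lemma sigmaFactor_zero_right (l : ℂ) : sigmaFactor l 0 = 1 := by simp [sigmaFactor]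

lemma differentiable_sigmaFactor (l : ℂ) : Differentiable ℂ (sigmaFactor l) := by
  unfold sigmaFactor
  simp only [div_eq_mul_inv]
  fun_prop

lemma sigmaFactor_ne_zero {l z : ℂ} (h : l ≠ 0 → z ≠ l) : sigmaFactor l z ≠ 0 := by
  rcases eq_or_ne l 0 with rfl | hl
  · simp
  · refine mul_ne_zero ?_ (Complex.exp_ne_zero _)
    rw [sub_ne_zero]
    intro h'
    exact h hl ((div_eq_one_iff_eq hl).1 h'.symm)

lemma logDeriv_sigmaFactor {l z : ℂ} (h : l ≠ 0 → z ≠ l) :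
    logDeriv (sigmaFactor l) z = z ^ 2 / (l ^ 2 * (z - l)) := by
  rcases eq_or_ne l 0 with rfl | hl
  · have : sigmaFactor 0 = fun _ => 1 := by ext; simp
    simp [this, logDeriv]
  have hzl : z - l ≠ 0 := sub_ne_zero.2 (h hl)
  have hlz : l - z ≠ 0 := by rw [← neg_sub]; exact neg_ne_zero.2 hzl
  have h1 : HasDerivAt (sigmaFactor l)
      (-(1 / l) * Complex.exp (z / l + (z / l) ^ 2 / 2) +
        (1 - z / l) * (Complex.exp (z / l + (z / l) ^ 2 / 2) *
          (1 / l + (2 * (z / l) * (1 / l)) / 2))) z := by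
    have hd : HasDerivAt (fun z : ℂ => z / l) (1 / l) z := (hasDerivAt_id z).div_const l
    have h2 : HasDerivAt (fun z : ℂ => z / l + (z / l) ^ 2 / 2)
        (1 / l + (2 * (z / l) * (1 / l)) / 2) z := by
      simpa using! hd.add ((hd.pow 2).div_const 2)
    simpa using! (hd.const_sub 1).mul h2.cexp
  rw [logDeriv_apply, h1.deriv, div_eq_iff (sigmaFactor_ne_zero h), sigmaFactor]
  field_simp
  ring

lemma norm_one_sub_mul_exp_sub_one_le {x : ℂ} (hx : ‖x‖ ≤ 1 / 2) :
    ‖(1 - x) * Complex.exp (x + x ^ 2 / 2) - 1‖ ≤ 3 * ‖x‖ ^ 3 := by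
  have hd : ∀ y : ℂ, HasDerivAt (fun y : ℂ => (1 - y) * Complex.exp (y + y ^ 2 / 2))
      (-y ^ 2 * Complex.exp (y + y ^ 2 / 2)) y := by
    intro y
    have h2 : HasDerivAt (fun y : ℂ => y + y ^ 2 / 2) (1 + (2 * y) / 2) y := by
      simpa using! (hasDerivAt_id y).add (((hasDerivAt_id y).pow 2).div_const 2)
    have := ((hasDerivAt_id y).const_sub 1).mul h2.cexp
    refine this.congr_deriv ?_
    simp only [id]
    ring
  have hb : ∀ y ∈ Metric.closedBall (0 : ℂ) ‖x‖,
      ‖-y ^ 2 * Complex.exp (y + y ^ 2 / 2)‖ ≤ 3 * ‖x‖ ^ 2 := by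
    intro y hy
    have hy : ‖y‖ ≤ ‖x‖ := by simpa using hy
    have he : ‖Complex.exp (y + y ^ 2 / 2)‖ ≤ 3 := by
      refine (Complex.norm_exp_le_exp_norm _).trans ?_
      have h1 : ‖y + y ^ 2 / 2‖ ≤ 1 := by
        refine (norm_add_le _ _).trans ?_
        rw [norm_div, norm_pow, Complex.norm_ofNat]
        nlinarith [norm_nonneg y]
      exact (Real.exp_le_exp.2 h1).trans Real.exp_one_lt_three.le
    rw [norm_mul, norm_neg, norm_pow, mul_comm]
    gcongr
  have := (convex_closedBall (0 : ℂ) ‖x‖).norm_image_sub_le_of_norm_hasDerivWithin_le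
    (fun y _ => (hd y).hasDerivWithinAt) hb (x := 0) (y := x) (by simp) (by simp)
  simpa [pow_succ, mul_assoc] using this

namespace PeriodPair

variable (L : PeriodPair)

lemma norm_sigmaFactor_sub_one_le {r : ℝ} (hr : 0 < r) {z : ℂ} (hz : ‖z‖ ≤ r) {l : ℂ}
    (hl : 2 * r ≤ ‖l‖) : ‖sigmaFactor l z - 1‖ ≤ 3 * r ^ 3 * ‖l‖ ^ (-3 : ℝ) := by
  have hl0 : 0 < ‖l‖ := by linarith
  have h1 : ‖z / l‖ ≤ 1 / 2 := by
    rw [norm_div, div_le_iff₀ hl0]; linarith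
  refine (norm_one_sub_mul_exp_sub_one_le h1).trans ?_
  rw [norm_div, div_pow, Real.rpow_neg hl0.le, mul_assoc, div_eq_mul_inv]
  norm_cast
  gcongr

lemma summable_norm_rpow_lattice : Summable fun l : L.lattice => ‖(l : ℂ)‖ ^ (-3 : ℝ) :=
  ZLattice.summable_norm_rpow _ _ (by simp; norm_num)

lemma eventually_cofinite_le_norm (R : ℝ) : ∀ᶠ l : L.lattice in cofinite, R ≤ ‖(l : ℂ)‖ := by
  refine (isCompact_iff_finite.mp (isCompact_closedBall (0 : L.lattice) R)).subset ?_
  intro l hl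
  simp only [mem_ofPred_eq, mem_compl_iff, not_le] at hl
  simpa using hl.le

lemma summable_norm_sigmaFactor_sub_one (z : ℂ) :
    Summable fun l : L.lattice => ‖sigmaFactor l z - 1‖ := by
  refine Summable.of_norm_bounded_eventually
    (L.summable_norm_rpow_lattice.mul_left (3 * (‖z‖ + 1) ^ 3)) ?_
  filter_upwards [L.eventually_cofinite_le_norm (2 * (‖z‖ + 1))] with l hl
  rw [norm_norm]
  exact norm_sigmaFactor_sub_one_le (by positivity) (by linarith) hl

/-- The product of the canonical factors over the lattice, so that `σ(z) = z * sigmaProd z`. -/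
def sigmaProd (z : ℂ) : ℂ := ∏' l : L.lattice, sigmaFactor l z

lemma hasProdLocallyUniformlyOn_sigmaProd :
    HasProdLocallyUniformlyOn (fun (l : L.lattice) z => sigmaFactor l z) L.sigmaProd univ := by
  refine hasProdLocallyUniformlyOn_of_forall_compact isOpen_univ fun K _ hK => ?_
  obtain ⟨r, hr, hKr⟩ : ∃ r > 0, ∀ z ∈ K, ‖z‖ ≤ r := hK.isBounded.exists_pos_norm_le
  have := Summable.hasProdUniformlyOn_one_add
    (f := fun (l : L.lattice) z => sigmaFactor l z - 1) hK
    (L.summable_norm_rpow_lattice.mul_left (3 * r ^ 3)) (by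
      filter_upwards [L.eventually_cofinite_le_norm (2 * r)] with l hl z hz
      exact norm_sigmaFactor_sub_one_le hr (hKr z hz) hl)
    (fun l => ((differentiable_sigmaFactor l).continuous.sub continuous_const).continuousOn)
  simpa [sigmaProd] using! this

lemma differentiable_sigmaProd : Differentiable ℂ L.sigmaProd := by
  rw [← differentiableOn_univ]
  refine L.hasProdLocallyUniformlyOn_sigmaProd.differentiableOn (.of_forall fun s => ?_) isOpen_univ
  simpa [Finset.prod_fn] using
    DifferentiableOn.finsetProd (u := s) (f := fun (l : L.lattice) z => sigmaFactor l z)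
      fun l _ => (differentiable_sigmaFactor (l : ℂ)).differentiableOn

lemma sigmaProd_zero : L.sigmaProd 0 = 1 := by simp [sigmaProd]

lemma sigmaProd_neg (z : ℂ) : L.sigmaProd (-z) = L.sigmaProd z := by
  simp only [sigmaProd]
  rw [← (Equiv.neg L.lattice).tprod_eq]
  congr with l
  simp [sigmaFactor]

lemma sigmaProd_ne_zero {z : ℂ} (hz : z ∉ (L.lattice : Set ℂ) \ {0}) : L.sigmaProd z ≠ 0 := by
  have := tprod_one_add_ne_zero_of_summable (f := fun l : L.lattice => sigmaFactor l z - 1)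
    (fun l => by
      rw [add_sub_cancel]
      refine sigmaFactor_ne_zero ?_
      rintro h rfl
      exact hz ⟨l.2, h⟩) (L.summable_norm_sigmaFactor_sub_one z)
  simpa [sigmaProd] using this

lemma sigmaProd_eq_zero {z : ℂ} (hz : z ∈ (L.lattice : Set ℂ) \ {0}) : L.sigmaProd z = 0 := by
  refine tprod_of_exists_eq_zero ⟨⟨z, hz.1⟩, ?_⟩
  have : z ≠ 0 := hz.2
  simp [sigmaFactor, this]

lemma weierstrassSigma_eq (z : ℂ) : weierstrassSigma L z = z * L.sigmaProd z := by
  rw [weierstrassSigma, sigmaProd]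
  congr 1
  refine tprod_subtype_eq_of_mulSupport_subset (s := {l : L.lattice | l ≠ 0})
    (f := fun l : L.lattice => sigmaFactor l z) ?_
  intro l hl h
  simp [h] at hl

lemma differentiable_weierstrassSigma : Differentiable ℂ (weierstrassSigma L) := by
  rw [funext L.weierstrassSigma_eq]
  exact differentiable_id.mul L.differentiable_sigmaProd

@[simp] lemma weierstrassSigma_neg (z : ℂ) : weierstrassSigma L (-z) = -weierstrassSigma L z := by
  simp [weierstrassSigma_eq, sigmaProd_neg]

lemma weierstrassSigma_eq_zero_iff {z : ℂ} : weierstrassSigma L z = 0 ↔ z ∈ L.lattice := by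
  rw [weierstrassSigma_eq, mul_eq_zero]
  constructor
  · rintro (rfl | h)
    · exact zero_mem _
    · by_contra h'
      exact L.sigmaProd_ne_zero (fun h'' => h' h''.1) h
  · intro h
    by_cases h0 : z = 0
    · exact .inl h0
    · exact .inr (L.sigmaProd_eq_zero ⟨h, h0⟩)

@[simp] lemma weierstrassSigma_zero : weierstrassSigma L 0 = 0 := by simp [weierstrassSigma_eq]

/-! ### The Weierstrass zeta function -/

/-- The regular part `ζ(z) - 1 / z` of the zeta function at the origin. -/
def zetaExcept (z : ℂ) : ℂ := ∑' l : L.lattice, z ^ 2 / ((l : ℂ) ^ 2 * (z - l))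

lemma hasSumLocallyUniformly_zetaExcept :
    HasSumLocallyUniformly (fun (l : L.lattice) (z : ℂ) => z ^ 2 / ((l : ℂ) ^ 2 * (z - l)))
      L.zetaExcept := by
  refine L.hasSumLocallyUniformly_aux (u := fun r l => 2 * r ^ 2 * ‖(l : ℂ)‖ ^ (-3 : ℝ)) _
    (fun r _ => L.summable_norm_rpow_lattice.mul_left _) fun r hr =>
    Filter.eventually_atTop.mpr ⟨2 * r, ?_⟩
  rintro _ h z hz l rfl
  have hl0 : 0 < ‖(l : ℂ)‖ := by linarith
  have h1 : ‖(l : ℂ)‖ / 2 ≤ ‖z - l‖ := by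
    rw [norm_sub_rev]
    have := norm_sub_norm_le (l : ℂ) z
    linarith
  rw [norm_div, norm_mul, norm_pow, norm_pow, Real.rpow_neg hl0.le, ← div_eq_mul_inv]
  calc ‖z‖ ^ 2 / (‖(l : ℂ)‖ ^ 2 * ‖z - l‖) ≤ r ^ 2 / (‖(l : ℂ)‖ ^ 2 * (‖(l : ℂ)‖ / 2)) := by gcongr
    _ = 2 * r ^ 2 / ‖(l : ℂ)‖ ^ 3 := by field_simp
    _ = _ := by norm_cast

lemma hasDerivAt_zetaExcept {z : ℂ} (hz : z ∉ (L.lattice : Set ℂ) \ {0}) :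
    HasDerivAt L.zetaExcept (-L.weierstrassPExcept 0 z) z := by
  have hU := L.isOpen_compl_lattice_sdiff (s := {0})
  have hd : ∀ l : L.lattice, ∀ y ∈ ((L.lattice : Set ℂ) \ {0})ᶜ,
      HasDerivAt (fun z : ℂ => z ^ 2 / ((l : ℂ) ^ 2 * (z - l)))
        (-if (l : ℂ) = 0 then 0 else (1 / (y - l) ^ 2 - 1 / (l : ℂ) ^ 2)) y := by
    intro l y hy
    split_ifs with hl
    · simpa [hl] using hasDerivAt_const y (0 : ℂ)
    · have hyl : y - l ≠ 0 := by
        rw [sub_ne_zero]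
        rintro rfl
        exact hy ⟨l.2, hl⟩
      have h1 : HasDerivAt (fun z : ℂ => (l : ℂ) ^ 2 * (z - l)) ((l : ℂ) ^ 2) y := by
        simpa using ((hasDerivAt_id y).sub_const (l : ℂ)).const_mul ((l : ℂ) ^ 2)
      have h2 : HasDerivAt (fun z : ℂ => z ^ 2) (2 * y) y := by simpa using hasDerivAt_pow 2 y
      refine (h2.div h1 (mul_ne_zero (pow_ne_zero 2 hl) hyl)).congr_deriv ?_
      field_simp
      ring
  have hS := L.hasSumLocallyUniformly_zetaExcept.hasSumLocallyUniformlyOn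
    (s := ((L.lattice : Set ℂ) \ {0})ᶜ)
  have hdiff : ∀ s : Finset L.lattice, DifferentiableOn ℂ
      (fun z => ∑ l ∈ s, z ^ 2 / ((l : ℂ) ^ 2 * (z - l))) ((L.lattice : Set ℂ) \ {0})ᶜ :=
    fun s y hy => (HasDerivAt.fun_sum fun l _ => hd l y hy).differentiableAt.differentiableWithinAt
  have hS' : TendstoLocallyUniformlyOn
      (fun (s : Finset L.lattice) z => ∑ l ∈ s, z ^ 2 / ((l : ℂ) ^ 2 * (z - l)))
      L.zetaExcept atTop ((L.lattice : Set ℂ) \ {0})ᶜ := by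
    simpa using! hS
  have h1 := (hS'.deriv (.of_forall hdiff) hU).tendsto_at hz
  have h2 : HasSum (fun l : L.lattice =>
      -if (l : ℂ) = 0 then 0 else (1 / (z - l) ^ 2 - 1 / (l : ℂ) ^ 2))
      (-L.weierstrassPExcept 0 z) := (L.hasSum_weierstrassPExcept 0 z).neg
  have h3 := tendsto_nhds_unique (h1.congr fun s => by
    exact (HasDerivAt.fun_sum fun l _ => hd l z hz).deriv) h2
  rw [← h3]
  exact ((hS'.differentiableOn (.of_forall hdiff) hU).differentiableAt
    (hU.mem_nhds hz)).hasDerivAt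

lemma logDeriv_sigmaProd {z : ℂ} (hz : z ∉ (L.lattice : Set ℂ) \ {0}) :
    logDeriv L.sigmaProd z = L.zetaExcept z := by
  have hne : ∀ l : L.lattice, (l : ℂ) ≠ 0 → z ≠ l := by
    rintro l hl rfl
    exact hz ⟨l.2, hl⟩
  have h1 : ∀ l : L.lattice, logDeriv (sigmaFactor l) z = z ^ 2 / ((l : ℂ) ^ 2 * (z - l)) :=
    fun l => logDeriv_sigmaFactor (hne l)
  have := logDeriv_tprod_eq_tsum (f := fun (l : L.lattice) z => sigmaFactor l z) isOpen_univ
    (mem_univ z) (fun l => sigmaFactor_ne_zero (hne l))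
    (fun l => (differentiable_sigmaFactor l).differentiableOn)
    (by simpa only [h1] using L.hasSumLocallyUniformly_zetaExcept.hasSum.summable)
    L.hasProdLocallyUniformlyOn_sigmaProd.multipliableLocallyUniformlyOn
    (L.sigmaProd_ne_zero hz)
  simpa only [h1] using! this

lemma weierstrassZeta_eq {z : ℂ} (hz : z ∉ L.lattice) :
    weierstrassZeta L z = 1 / z + L.zetaExcept z := by
  have hz0 : z ≠ 0 := by rintro rfl; exact hz (zero_mem _)
  have hz' : z ∉ (L.lattice : Set ℂ) \ {0} := fun h => hz h.1
  rw [← L.logDeriv_sigmaProd hz', ← logDeriv_id,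
    ← logDeriv_mul (f := id) z hz0 (L.sigmaProd_ne_zero hz') differentiableAt_id
      (L.differentiable_sigmaProd z), logDeriv_apply, weierstrassZeta,
    show weierstrassSigma L = fun z => id z * L.sigmaProd z from funext L.weierstrassSigma_eq]

lemma hasDerivAt_weierstrassZeta {z : ℂ} (hz : z ∉ L.lattice) :
    HasDerivAt (weierstrassZeta L) (-L.weierstrassP z) z := by
  have hz0 : z ≠ 0 := by rintro rfl; exact hz (zero_mem _)
  have h := ((hasDerivAt_inv hz0).add
    (L.hasDerivAt_zetaExcept (z := z) fun h => hz h.1)).congr_of_eventuallyEq (f₁ := weierstrassZeta L)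
      (by
        filter_upwards [L.isClosed_lattice.isOpen_compl.mem_nhds hz] with y hy
        simpa using L.weierstrassZeta_eq hy)
  refine h.congr_deriv ?_
  rw [← L.weierstrassPExcept_add 0 z]
  simp

lemma hasDerivAt_weierstrassSigma {z : ℂ} (hz : z ∉ L.lattice) :
    HasDerivAt (weierstrassSigma L) (weierstrassZeta L z * weierstrassSigma L z) z := by
  rw [weierstrassZeta, div_mul_cancel₀ _ (mt L.weierstrassSigma_eq_zero_iff.1 hz)]
  exact (L.differentiable_weierstrassSigma z).hasDerivAt

@[simp] lemma weierstrassZeta_neg (z : ℂ) : weierstrassZeta L (-z) = -weierstrassZeta L z := by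
  have h : deriv (weierstrassSigma L) (-z) = deriv (weierstrassSigma L) z := by
    have := deriv_comp_neg (weierstrassSigma L) z
    simp only [weierstrassSigma_neg] at this
    rw [← neg_inj, ← this]
    exact deriv.fun_neg
  simp [weierstrassZeta, h, div_neg]

lemma isOpen_compl_lattice : IsOpen (L.lattice : Set ℂ)ᶜ := L.isClosed_lattice.isOpen_compl

lemma countable_lattice : (L.lattice : Set ℂ).Countable :=
  Set.countable_coe_iff.1 (inferInstanceAs (Countable L.lattice))

lemma isPreconnected_compl_lattice : IsPreconnected (L.lattice : Set ℂ)ᶜ :=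
  (L.countable_lattice.isConnected_compl_of_one_lt_rank
    (by rw [Complex.rank_real_complex]; exact Cardinal.one_lt_two)).isPreconnected

lemma add_notMem_lattice {z l : ℂ} (hz : z ∉ L.lattice) (hl : l ∈ L.lattice) :
    z + l ∉ L.lattice := fun h => hz ((L.lattice.add_mem_iff_left hl).1 h)

lemma neg_notMem_lattice {z : ℂ} (hz : z ∉ L.lattice) : -z ∉ L.lattice :=
  fun h => hz (by simpa using h)

lemma eventually_notMem_lattice (x : ℂ) : ∀ᶠ z in 𝓝[≠] x, z ∉ L.lattice := by
  filter_upwards [mem_nhdsWithin_of_mem_nhds (L.compl_lattice_sdiff_singleton_mem_nhds x),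
    self_mem_nhdsWithin] with z hz hzx hzL
  exact hz ⟨hzL, hzx⟩

lemma hasDerivAt_weierstrassP {z : ℂ} (hz : z ∉ L.lattice) :
    HasDerivAt L.weierstrassP (L.derivWeierstrassP z) z := by
  rw [← deriv_weierstrassP]
  exact (L.differentiableOn_weierstrassP.differentiableAt
    (L.isOpen_compl_lattice.mem_nhds hz)).hasDerivAt

/-- **Liouville's theorem for elliptic functions**: a function which is holomorphic and periodic off
the lattice and has a removable singularity at the origin is constant off the lattice. -/
lemma eq_of_periodic_of_removable {f n : ℂ → ℂ}
    (hper : ∀ z ∉ L.lattice, ∀ l ∈ L.lattice, f (z + l) = f z)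
    (hf : DifferentiableOn ℂ f (L.lattice : Set ℂ)ᶜ) (hn : AnalyticAt ℂ n 0)
    (heq : f =ᶠ[𝓝[≠] 0] n) {z : ℂ} (hz : z ∉ L.lattice) : f z = n 0 := by
  classical
  set F : ℂ → ℂ := fun z => if z ∈ L.lattice then n 0 else f z with hF
  have hFper : ∀ l ∈ L.lattice, ∀ z, F (z + l) = F z := by
    intro l hl z
    by_cases h : z ∈ L.lattice
    · simp [hF, h, add_mem h hl]
    · simp [hF, h, L.add_notMem_lattice h hl, hper z h l hl]
  have h0 : F =ᶠ[𝓝 0] n := by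
    refine (eventually_nhdsWithin_iff.1 (heq.and (L.eventually_notMem_lattice 0))).mono ?_
    intro y hy
    by_cases hy0 : y = 0
    · simp [hF, hy0]
    · obtain ⟨h1, h2⟩ := hy hy0
      simp [hF, h2, h1]
  have hd0 : DifferentiableAt ℂ F 0 := hn.differentiableAt.congr_of_eventuallyEq h0
  have hd : Differentiable ℂ F := by
    intro x
    by_cases hx : x ∈ L.lattice
    · have h1 : DifferentiableAt ℂ (fun y => F (y - x)) x := by
        have h2 : DifferentiableAt ℂ F (x - x) := by rwa [sub_self]
        exact DifferentiableAt.comp (f := fun y => y - x) x h2 (differentiableAt_id.sub_const x)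
      refine h1.congr_of_eventuallyEq (.of_forall fun y => ?_)
      have := hFper x hx (y - x)
      rwa [sub_add_cancel] at this
    · refine (hf.differentiableAt (L.isOpen_compl_lattice.mem_nhds hx)).congr_of_eventuallyEq ?_
      filter_upwards [L.isOpen_compl_lattice.mem_nhds hx] with y hy
      simp [hF, show y ∉ L.lattice from hy]
  have := hd.apply_eq_apply_of_bounded (IsZLattice.isCompact_range_of_periodic L.lattice _
    hd.continuous fun z w hw => hFper w hw z).isBounded z 0
  simpa [hF, hz] using this

lemma exists_weierstrassZeta_add {l : ℂ} (hl : l ∈ L.lattice) :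
    ∃ η : ℂ, ∀ z ∉ L.lattice, weierstrassZeta L (z + l) = weierstrassZeta L z + η := by
  have hd : ∀ z ∈ (L.lattice : Set ℂ)ᶜ,
      HasDerivAt (fun z => weierstrassZeta L (z + l) - weierstrassZeta L z) 0 z := by
    intro z hz
    have h1 := (L.hasDerivAt_weierstrassZeta (L.add_notMem_lattice hz hl)).comp_add_const z l
    refine (h1.sub (L.hasDerivAt_weierstrassZeta hz)).congr_deriv ?_
    rw [L.weierstrassP_add_coe z ⟨l, hl⟩, sub_self]
  obtain ⟨η, hη⟩ := L.isOpen_compl_lattice.exists_is_const_of_deriv_eq_zero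
    L.isPreconnected_compl_lattice
    (fun z hz => (hd z hz).differentiableAt.differentiableWithinAt) (fun z hz => (hd z hz).deriv)
  exact ⟨η, fun z hz => by rw [← hη z hz]; ring⟩

lemma exists_weierstrassSigma_add {l : ℂ} (hl : l ∈ L.lattice) :
    ∃ C η : ℂ, ∀ z, weierstrassSigma L (z + l) = C * Complex.exp (η * z) * weierstrassSigma L z := by
  obtain ⟨η, hη⟩ := L.exists_weierstrassZeta_add hl
  have hd : ∀ z ∈ (L.lattice : Set ℂ)ᶜ, HasDerivAt (fun z => weierstrassSigma L (z + l) *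
      (Complex.exp (-(η * z)) / weierstrassSigma L z)) 0 z := by
    intro z hz
    have h0 := mt L.weierstrassSigma_eq_zero_iff.1 hz
    have h1 := (L.hasDerivAt_weierstrassSigma (L.add_notMem_lattice hz hl)).comp_add_const z l
    have h2 : HasDerivAt (fun z => Complex.exp (-(η * z))) (Complex.exp (-(η * z)) * -η) z := by
      simpa using (((hasDerivAt_id z).const_mul η).neg).cexp
    refine (h1.mul (h2.div (L.hasDerivAt_weierstrassSigma hz) h0)).congr_deriv ?_
    rw [hη z hz]
    simp only [Pi.div_apply]
    field_simp
    ring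
  obtain ⟨C, hC⟩ := L.isOpen_compl_lattice.exists_is_const_of_deriv_eq_zero
    L.isPreconnected_compl_lattice
    (fun z hz => (hd z hz).differentiableAt.differentiableWithinAt) (fun z hz => (hd z hz).deriv)
  refine ⟨C, η, fun z => ?_⟩
  by_cases hz : z ∈ L.lattice
  · rw [L.weierstrassSigma_eq_zero_iff.2 hz, L.weierstrassSigma_eq_zero_iff.2 (add_mem hz hl),
      mul_zero]
  · have h0 := mt L.weierstrassSigma_eq_zero_iff.1 hz
    rw [← hC z hz, Complex.exp_neg]
    have := Complex.exp_ne_zero (η * z)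
    field_simp

lemma weierstrassP_add_sigma_quotient_add {w l z : ℂ} (hl : l ∈ L.lattice) :
    L.weierstrassP (z + l) + weierstrassSigma L (z + l - w) * weierstrassSigma L (z + l + w) /
        (weierstrassSigma L (z + l) ^ 2 * weierstrassSigma L w ^ 2) =
      L.weierstrassP z + weierstrassSigma L (z - w) * weierstrassSigma L (z + w) /
        (weierstrassSigma L z ^ 2 * weierstrassSigma L w ^ 2) := by
  obtain ⟨C, η, h⟩ := L.exists_weierstrassSigma_add hl
  have hC : C ≠ 0 := by
    rintro rfl
    refine L.ω₁_div_two_notMem_lattice (L.weierstrassSigma_eq_zero_iff.1 ?_)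
    simpa using h (L.ω₁ / 2 - l)
  rw [L.weierstrassP_add_coe z ⟨l, hl⟩, show z + l - w = z - w + l by ring,
    show z + l + w = z + w + l by ring, h, h, h]
  have he := Complex.exp_ne_zero (η * z)
  have h2 : Complex.exp (η * (z - w)) * Complex.exp (η * (z + w)) = Complex.exp (η * z) ^ 2 := by
    rw [← Complex.exp_add, ← Complex.exp_nat_mul]
    congr 1
    push_cast
    ring
  congr 1
  rw [show C * Complex.exp (η * (z - w)) * weierstrassSigma L (z - w) *
      (C * Complex.exp (η * (z + w)) * weierstrassSigma L (z + w)) =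
      (C ^ 2 * (Complex.exp (η * (z - w)) * Complex.exp (η * (z + w)))) *
        (weierstrassSigma L (z - w) * weierstrassSigma L (z + w)) by ring, h2,
    show (C * Complex.exp (η * z) * weierstrassSigma L z) ^ 2 * weierstrassSigma L w ^ 2 =
      (C ^ 2 * Complex.exp (η * z) ^ 2) *
        (weierstrassSigma L z ^ 2 * weierstrassSigma L w ^ 2) by ring,
    mul_div_mul_left _ _ (mul_ne_zero (pow_ne_zero 2 hC) (pow_ne_zero 2 he))]

/-- `℘(u) - ℘(w) = -σ(u - w) σ(u + w) / (σ(u)² σ(w)²)` -/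
theorem weierstrassP_sub_weierstrassP {u w : ℂ} (hu : u ∉ L.lattice) (hw : w ∉ L.lattice) :
    L.weierstrassP u - L.weierstrassP w =
      -(weierstrassSigma L (u - w) * weierstrassSigma L (u + w) /
        (weierstrassSigma L u ^ 2 * weierstrassSigma L w ^ 2)) := by
  have hσw := mt L.weierstrassSigma_eq_zero_iff.1 hw
  have hσ := L.differentiable_weierstrassSigma
  set N : ℂ → ℂ := fun z => 1 + weierstrassSigma L (z - w) * weierstrassSigma L (z + w) /
    (L.sigmaProd z ^ 2 * weierstrassSigma L w ^ 2) with hN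
  have hs0 : L.sigmaProd 0 ≠ 0 := by simp [sigmaProd_zero]
  have hNan : AnalyticAt ℂ N 0 := by
    have h1 : AnalyticAt ℂ L.sigmaProd 0 := L.differentiable_sigmaProd.analyticAt 0
    have h2 : AnalyticAt ℂ (fun z => weierstrassSigma L (z - w)) 0 :=
      (hσ.comp (differentiable_id.sub_const w)).analyticAt 0
    have h3 : AnalyticAt ℂ (fun z => weierstrassSigma L (z + w)) 0 :=
      (hσ.comp (differentiable_id.add_const w)).analyticAt 0
    refine analyticAt_const.add ((h2.mul h3).div ((h1.pow 2).mul analyticAt_const) ?_)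
    exact mul_ne_zero (pow_ne_zero 2 hs0) (pow_ne_zero 2 hσw)
  have hN0 : N 0 = 0 := by
    simp [hN, sigmaProd_zero]
    field_simp
    ring
  have hNeven : ∀ z, N (-z) = N z := by
    intro z
    simp only [hN, sigmaProd_neg]
    rw [show -z - w = -(z + w) by ring, show -z + w = -(z - w) by ring, weierstrassSigma_neg,
      weierstrassSigma_neg]
    ring
  have hN1 : deriv N 0 = 0 := by
    have h := deriv_comp_neg N 0
    simp only [hNeven, neg_zero] at h
    exact self_eq_neg.1 h
  obtain ⟨p, hp⟩ := hNan
  have hD : AnalyticAt ℂ (dslope (dslope N 0) 0) 0 :=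
    ⟨_, hp.has_fpower_series_dslope_fslope.has_fpower_series_dslope_fslope⟩
  have key : ∀ z ∉ L.lattice, L.weierstrassP z +
      weierstrassSigma L (z - w) * weierstrassSigma L (z + w) /
        (weierstrassSigma L z ^ 2 * weierstrassSigma L w ^ 2) =
      L.weierstrassPExcept 0 0 + dslope (dslope N 0) 0 0 := by
    intro z hz
    refine L.eq_of_periodic_of_removable
      (f := fun z => L.weierstrassP z + weierstrassSigma L (z - w) * weierstrassSigma L (z + w) /
        (weierstrassSigma L z ^ 2 * weierstrassSigma L w ^ 2))
      (n := fun z => L.weierstrassPExcept 0 z + dslope (dslope N 0) 0 z)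
      (fun z _ l hl => L.weierstrassP_add_sigma_quotient_add hl) ?_
      ((L.analyticAt_weierstrassPExcept 0).add hD) ?_ hz
    · refine L.differentiableOn_weierstrassP.add (DifferentiableOn.div ?_ ?_ ?_)
      · exact ((hσ.comp (differentiable_id.sub_const w)).mul
          (hσ.comp (differentiable_id.add_const w))).differentiableOn
      · exact ((hσ.pow 2).mul_const _).differentiableOn
      · intro y hy
        exact mul_ne_zero (pow_ne_zero 2 (mt L.weierstrassSigma_eq_zero_iff.1 hy))
          (pow_ne_zero 2 hσw)
    · filter_upwards [L.eventually_notMem_lattice 0, self_mem_nhdsWithin] with y hy hy0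
      have hy0 : y ≠ 0 := hy0
      have hsy : L.sigmaProd y ≠ 0 := L.sigmaProd_ne_zero fun h => hy h.1
      rw [dslope_of_ne _ hy0, slope_def_field, dslope_same, hN1, dslope_of_ne _ hy0,
        slope_def_field, hN0, ← L.weierstrassPExcept_add 0 y]
      simp only [hN, L.weierstrassSigma_eq y]
      simp
      field_simp
      ring
  have h1 := key u hu
  rw [← key w hw, sub_self, weierstrassSigma_zero, zero_mul, zero_div, add_zero] at h1
  linear_combination h1

lemma weierstrassP_eq_iff {u w : ℂ} (hu : u ∉ L.lattice) (hw : w ∉ L.lattice) :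
    L.weierstrassP u = L.weierstrassP w ↔ u - w ∈ L.lattice ∨ u + w ∈ L.lattice := by
  rw [← sub_eq_zero, L.weierstrassP_sub_weierstrassP hu hw, neg_eq_zero, div_eq_zero_iff,
    mul_eq_zero, mul_eq_zero, pow_eq_zero_iff two_ne_zero, pow_eq_zero_iff two_ne_zero]
  simp [weierstrassSigma_eq_zero_iff, hu, hw]

/-- `℘'(w) = (℘(u) - ℘(w)) (ζ(u - w) - ζ(u + w) + 2 ζ(w))` -/
theorem derivWeierstrassP_eq_mul_zeta {u w : ℂ} (hu : u ∉ L.lattice) (hw : w ∉ L.lattice)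
    (h₁ : u - w ∉ L.lattice) (h₂ : u + w ∉ L.lattice) :
    L.derivWeierstrassP w = (L.weierstrassP u - L.weierstrassP w) *
      (weierstrassZeta L (u - w) - weierstrassZeta L (u + w) + 2 * weierstrassZeta L w) := by
  have hσw := mt L.weierstrassSigma_eq_zero_iff.1 hw
  have hσu := mt L.weierstrassSigma_eq_zero_iff.1 hu
  have d1 : HasDerivAt (fun y => weierstrassSigma L (u - y))
      (-(weierstrassZeta L (u - w) * weierstrassSigma L (u - w))) w :=
    (L.hasDerivAt_weierstrassSigma h₁).comp_const_sub u w
  have d2 : HasDerivAt (fun y => weierstrassSigma L (u + y))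
      (weierstrassZeta L (u + w) * weierstrassSigma L (u + w)) w :=
    (L.hasDerivAt_weierstrassSigma h₂).comp_const_add u w
  have d3 := ((L.hasDerivAt_weierstrassSigma hw).pow 2).const_mul (weierstrassSigma L u ^ 2)
  have d4 := ((d1.mul d2).div d3 (mul_ne_zero (pow_ne_zero 2 hσu) (pow_ne_zero 2 hσw))).neg
  have d5 := ((L.hasDerivAt_weierstrassP hw).const_sub (L.weierstrassP u)).congr_of_eventuallyEq
    (f₁ := fun y => -(weierstrassSigma L (u - y) * weierstrassSigma L (u + y) /
        (weierstrassSigma L u ^ 2 * weierstrassSigma L y ^ 2))) (by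
      filter_upwards [L.isOpen_compl_lattice.mem_nhds hw] with y hy
      exact (L.weierstrassP_sub_weierstrassP hu hy).symm)
  have := d5.unique d4
  rw [L.weierstrassP_sub_weierstrassP hu hw, ← neg_inj, this]
  simp only [Pi.mul_apply, Pi.pow_apply]
  field_simp
  ring

lemma exists_derivWeierstrassP_ne_zero : ∃ z ∉ L.lattice, L.derivWeierstrassP z ≠ 0 := by
  by_contra! h
  obtain ⟨a, ha⟩ := L.isOpen_compl_lattice.exists_is_const_of_deriv_eq_zero
    L.isPreconnected_compl_lattice L.differentiableOn_weierstrassP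
    (fun z hz => by rw [deriv_weierstrassP]; exact h z hz)
  have h1 := (L.weierstrassP_eq_iff L.ω₁_div_two_notMem_lattice L.ω₂_div_two_notMem_lattice).1
    ((ha _ L.ω₁_div_two_notMem_lattice).trans (ha _ L.ω₂_div_two_notMem_lattice).symm)
  have h2 := (L.mul_ω₁_add_mul_ω₂_mem_lattice (α := 1 / 2) (β := 1 / 2)).not.mpr (by norm_num)
  have h3 := (L.mul_ω₁_add_mul_ω₂_mem_lattice (α := 1 / 2) (β := -(1 / 2))).not.mpr (by norm_num)
  push_cast at h2 h3
  rcases h1 with h1 | h1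
  · exact h3 (by convert h1 using 1; ring)
  · exact h2 (by convert h1 using 1; ring)

/-- `℘'' = 6 ℘² - g₂ / 2` -/
lemma hasDerivAt_derivWeierstrassP {z : ℂ} (hz : z ∉ L.lattice) :
    HasDerivAt L.derivWeierstrassP (6 * L.weierstrassP z ^ 2 - L.g₂ / 2) z := by
  have hd : ∀ y ∉ L.lattice, HasDerivAt L.derivWeierstrassP (deriv L.derivWeierstrassP y) y :=
    fun y hy => (L.analyticOnNhd_derivWeierstrassP y hy).differentiableAt.hasDerivAt
  have hmul : ∀ y ∈ (L.lattice : Set ℂ)ᶜ, L.derivWeierstrassP y *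
      (deriv L.derivWeierstrassP y - (6 * L.weierstrassP y ^ 2 - L.g₂ / 2)) = 0 := by
    intro y hy
    have h1 := (hd y hy).pow 2
    have h2 := (((((L.hasDerivAt_weierstrassP hy).pow 3).const_mul 4).sub
      ((L.hasDerivAt_weierstrassP hy).const_mul L.g₂)).sub_const L.g₃).congr_of_eventuallyEq
      (f₁ := fun y => L.derivWeierstrassP y ^ 2) (by
        filter_upwards [L.isOpen_compl_lattice.mem_nhds hy] with x hx
        exact L.derivWeierstrassP_sq x hx)
    have h3 := h1.unique h2
    push_cast at h3
    linear_combination h3 / 2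
  have han := L.analyticOnNhd_derivWeierstrassP
  rcases AnalyticOnNhd.eq_zero_or_eq_zero_of_mul_eq_zero han
    (han.deriv.sub (((analyticOnNhd_const (v := (6 : ℂ))).mul
      (L.analyticOnNhd_weierstrassP.pow 2)).sub (analyticOnNhd_const (v := L.g₂ / 2))))
    hmul L.isPreconnected_compl_lattice with h | h
  · obtain ⟨y, hy, hy'⟩ := L.exists_derivWeierstrassP_ne_zero
    exact absurd (h y hy) hy'
  · have := h z hz
    rw [Pi.sub_apply, sub_eq_zero] at this
    exact (hd z hz).congr_deriv this

lemma countable_weierstrassP_eq (a : ℂ) : {u | u ∉ L.lattice ∧ L.weierstrassP u = a}.Countable := by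
  rcases {u | u ∉ L.lattice ∧ L.weierstrassP u = a}.eq_empty_or_nonempty with h | ⟨w, hw, hwa⟩
  · simp [h]
  refine ((L.countable_lattice.image (· + w)).union (L.countable_lattice.image (· - w))).mono ?_
  rintro u ⟨hu, hua⟩
  rcases (L.weierstrassP_eq_iff hu hw).1 (hua.trans hwa.symm) with h | h
  · exact .inl ⟨_, h, by simp⟩
  · exact .inr ⟨_, h, by simp⟩

end PeriodPair

namespace QuarticCurve

variable (E : QuarticCurve)

/-- The product `(a₁ - c) (a₂ - c) (a₃ - c)`. -/
def branchProd : ℂ := (E.a₁ - E.c) * (E.a₂ - E.c) * (E.a₃ - E.c)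

/-- The constant `h` in the transformation `z = h - branchProd / (λ - c)` to the Weierstrass
form. -/
def shift : ℂ := ((E.a₁ - E.c) * (E.a₂ - E.c) + (E.a₂ - E.c) * (E.a₃ - E.c) +
  (E.a₃ - E.c) * (E.a₁ - E.c)) / 3

lemma branchProd_ne_zero : E.branchProd ≠ 0 :=
  mul_ne_zero (mul_ne_zero (sub_ne_zero.2 E.c_ne₁.symm) (sub_ne_zero.2 E.c_ne₂.symm))
    (sub_ne_zero.2 E.c_ne₃.symm)

/-- The derivative of `U₄`. -/
def derivU₄ (x : ℂ) : ℂ := -((x - E.a₂) * (x - E.a₃) * (x - E.c) +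
  (x - E.a₁) * (x - E.a₃) * (x - E.c) + (x - E.a₁) * (x - E.a₂) * (x - E.c) +
  (x - E.a₁) * (x - E.a₂) * (x - E.a₃))

lemma hasDerivAt_U₄ (x : ℂ) : HasDerivAt E.U₄ (E.derivU₄ x) x := by
  have h : ∀ a : ℂ, HasDerivAt (fun y => y - a) 1 x := fun a => (hasDerivAt_id x).sub_const a
  refine (((((h E.a₁).mul (h E.a₂)).mul (h E.a₃)).mul (h E.c)).neg).congr_deriv ?_
  simp only [derivU₄, Pi.mul_apply]
  ring

lemma contDiff_derivU₄ : ContDiff ℝ 1 E.derivU₄ := by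
  unfold derivU₄
  fun_prop

lemma derivU₄_ne_zero {x : ℂ} (hx : E.U₄ x = 0) : E.derivU₄ x ≠ 0 := by
  have h₁₂ := sub_ne_zero.2 E.ne₁₂
  have h₁₃ := sub_ne_zero.2 E.ne₁₃
  have h₂₃ := sub_ne_zero.2 E.ne₂₃
  have h₁ := sub_ne_zero.2 E.c_ne₁
  have h₂ := sub_ne_zero.2 E.c_ne₂
  have h₃ := sub_ne_zero.2 E.c_ne₃
  have h₁₂' := sub_ne_zero.2 E.ne₁₂.symm
  have h₁₃' := sub_ne_zero.2 E.ne₁₃.symm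
  have h₂₃' := sub_ne_zero.2 E.ne₂₃.symm
  have h₁' := sub_ne_zero.2 E.c_ne₁.symm
  have h₂' := sub_ne_zero.2 E.c_ne₂.symm
  have h₃' := sub_ne_zero.2 E.c_ne₃.symm
  have : x = E.a₁ ∨ x = E.a₂ ∨ x = E.a₃ ∨ x = E.c := by
    simpa [U₄, sub_eq_zero, or_assoc] using hx
  rcases this with rfl | rfl | rfl | rfl <;> simp [derivU₄, *]

lemma U₄_c : E.U₄ E.c = 0 := by simp [U₄]

open Classical in
/-- The inverse of the Abel map, first coordinate. -/
def lamOf (L : PeriodPair) (u : ℂ) : ℂ :=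
  if u ∈ L.lattice then E.c else E.c + E.branchProd / (E.shift - L.weierstrassP u)

open Classical in
/-- The inverse of the Abel map, second coordinate. -/
def muOf (L : PeriodPair) (u : ℂ) : ℂ :=
  if u ∈ L.lattice then 0 else
    Complex.I * E.branchProd * L.derivWeierstrassP u / (2 * (E.shift - L.weierstrassP u) ^ 2)

variable {E} {L : PeriodPair}

lemma lamOf_of_mem {u : ℂ} (hu : u ∈ L.lattice) : E.lamOf L u = E.c := if_pos hu

lemma muOf_of_mem {u : ℂ} (hu : u ∈ L.lattice) : E.muOf L u = 0 := if_pos hu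

lemma lamOf_of_notMem {u : ℂ} (hu : u ∉ L.lattice) :
    E.lamOf L u = E.c + E.branchProd / (E.shift - L.weierstrassP u) := if_neg hu

lemma muOf_of_notMem {u : ℂ} (hu : u ∉ L.lattice) : E.muOf L u =
    Complex.I * E.branchProd * L.derivWeierstrassP u / (2 * (E.shift - L.weierstrassP u) ^ 2) :=
  if_neg hu

lemma lamOf_eq_c_iff {u : ℂ} (hu : L.weierstrassP u = E.shift → u ∈ L.lattice) :
    E.lamOf L u = E.c ↔ u ∈ L.lattice := by
  refine ⟨fun h => ?_, lamOf_of_mem⟩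
  by_contra hL
  rw [lamOf_of_notMem hL, add_eq_left, div_eq_zero_iff, sub_eq_zero] at h
  rcases h with h | h
  · exact E.branchProd_ne_zero h
  · exact hL (hu h.symm)

lemma weierstrassP_eq {u : ℂ} (hu : L.weierstrassP u = E.shift → u ∈ L.lattice)
    (hL : u ∉ L.lattice) : L.weierstrassP u = E.shift - E.branchProd / (E.lamOf L u - E.c) := by
  have h : E.shift - L.weierstrassP u ≠ 0 := sub_ne_zero.2 fun h => hL (hu h.symm)
  have := E.branchProd_ne_zero
  rw [lamOf_of_notMem hL, add_sub_cancel_left, div_div_cancel₀ this]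
  ring

lemma derivWeierstrassP_eq {u : ℂ} (hu : L.weierstrassP u = E.shift → u ∈ L.lattice)
    (hL : u ∉ L.lattice) : L.derivWeierstrassP u =
      -2 * Complex.I * E.branchProd * E.muOf L u / (E.lamOf L u - E.c) ^ 2 := by
  have h : E.shift - L.weierstrassP u ≠ 0 := sub_ne_zero.2 fun h => hL (hu h.symm)
  have := E.branchProd_ne_zero
  rw [lamOf_of_notMem hL, muOf_of_notMem hL, add_sub_cancel_left]
  field_simp
  simp [Complex.I_sq]

lemma eventually_lamOf_muOf_eq {l : ℂ} (hl : l ∈ L.lattice) {D : ℂ → ℂ}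
    (hD : D = fun z => E.shift * (z - l) ^ 2 - L.weierstrassPExcept l z * (z - l) ^ 2 - 1 +
      (z - l) ^ 2 * (l ^ 2)⁻¹) :
    (E.lamOf L =ᶠ[𝓝 l] fun z => E.c + E.branchProd * (z - l) ^ 2 / D z) ∧
    (E.muOf L =ᶠ[𝓝 l] fun z => Complex.I * E.branchProd *
      (L.derivWeierstrassPExcept l z * (z - l) ^ 3 - 2) * (z - l) / (2 * D z ^ 2)) := by
  have h : ∀ᶠ z in 𝓝 l, z ≠ l → z ∉ L.lattice :=
    eventually_nhdsWithin_iff.1 (L.eventually_notMem_lattice l)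
  have hDz : ∀ z, z ≠ l → D z = (z - l) ^ 2 * (E.shift - L.weierstrassP z) := by
    intro z hz
    have : z - l ≠ 0 := sub_ne_zero.2 hz
    rw [← L.weierstrassPExcept_add ⟨l, hl⟩, hD]
    simp only [one_div]
    field_simp
    ring
  constructor
  · filter_upwards [h] with z hz
    by_cases hzl : z = l
    · simp [hzl, lamOf_of_mem hl]
    · have : z - l ≠ 0 := sub_ne_zero.2 hzl
      rw [lamOf_of_notMem (hz hzl), hDz z hzl, mul_comm E.branchProd,
        mul_div_mul_left _ _ (pow_ne_zero 2 this)]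
  · filter_upwards [h] with z hz
    by_cases hzl : z = l
    · simp [hzl, muOf_of_mem hl]
    · have h0 : z - l ≠ 0 := sub_ne_zero.2 hzl
      have h1 : L.derivWeierstrassPExcept l z * (z - l) ^ 3 - 2 =
          (z - l) ^ 3 * L.derivWeierstrassP z := by
        rw [← L.derivWeierstrassPExcept_sub ⟨l, hl⟩]
        field_simp
      rw [muOf_of_notMem (hz hzl), hDz z hzl, h1]
      rw [show Complex.I * E.branchProd * ((z - l) ^ 3 * L.derivWeierstrassP z) * (z - l) =
        (z - l) ^ 4 * (Complex.I * E.branchProd * L.derivWeierstrassP z) by ring,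
        show 2 * ((z - l) ^ 2 * (E.shift - L.weierstrassP z)) ^ 2 =
          (z - l) ^ 4 * (2 * (E.shift - L.weierstrassP z) ^ 2) by ring,
        mul_div_mul_left _ _ (pow_ne_zero 4 h0)]

lemma analyticAt_lamOf_muOf {u : ℂ} (hu : L.weierstrassP u = E.shift → u ∈ L.lattice) :
    AnalyticAt ℂ (E.lamOf L) u ∧ AnalyticAt ℂ (E.muOf L) u := by
  by_cases hL : u ∈ L.lattice
  · obtain ⟨h1, h2⟩ := eventually_lamOf_muOf_eq (E := E) hL rfl
    have hp := L.analyticAt_weierstrassPExcept u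
    have hp' := L.analyticAt_derivWeierstrassPExcept u
    refine ⟨AnalyticAt.congr ?_ h1.symm, AnalyticAt.congr ?_ h2.symm⟩
    · fun_prop (disch := simp)
    · fun_prop (disch := simp)
  · have hp := L.analyticOnNhd_weierstrassP u hL
    have hp' := L.analyticOnNhd_derivWeierstrassP u hL
    have h : E.shift - L.weierstrassP u ≠ 0 := sub_ne_zero.2 fun h => hL (hu h.symm)
    have hev := L.isOpen_compl_lattice.mem_nhds hL
    constructor
    · refine AnalyticAt.congr
        (f := fun u => E.c + E.branchProd / (E.shift - L.weierstrassP u)) ?_ ?_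
      · fun_prop (disch := exact h)
      · filter_upwards [hev] with z hz using (lamOf_of_notMem hz).symm
    · refine AnalyticAt.congr (f := fun u => Complex.I * E.branchProd * L.derivWeierstrassP u /
        (2 * (E.shift - L.weierstrassP u) ^ 2)) ?_ ?_
      · fun_prop (disch := simpa using h)
      · filter_upwards [hev] with z hz using (muOf_of_notMem hz).symm

lemma e₁_eq : E.e₁ = E.shift - (E.a₂ - E.c) * (E.a₃ - E.c) := by
  simp only [e₁, shift]; ring

lemma e₂_eq : E.e₂ = E.shift - (E.a₃ - E.c) * (E.a₁ - E.c) := by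
  simp only [e₂, shift]; ring

lemma e₃_eq : E.e₃ = E.shift - (E.a₁ - E.c) * (E.a₂ - E.c) := by
  simp only [e₃, shift]; ring

lemma derivWeierstrassP_sq_eq (hg₂ : L.g₂ = E.g₂) (hg₃ : L.g₃ = E.g₃) {z : ℂ}
    (hz : z ∉ L.lattice) : L.derivWeierstrassP z ^ 2 =
      4 * (L.weierstrassP z - E.e₁) * (L.weierstrassP z - E.e₂) * (L.weierstrassP z - E.e₃) := by
  have h : E.e₁ + E.e₂ + E.e₃ = 0 := by simp only [e₁, e₂, e₃]; ring
  rw [L.derivWeierstrassP_sq z hz, hg₂, hg₃, g₂, g₃]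
  linear_combination 4 * L.weierstrassP z ^ 2 * h

lemma lamOf_muOf_mem_points (hg₂ : L.g₂ = E.g₂) (hg₃ : L.g₃ = E.g₃) {u : ℂ}
    (hu : L.weierstrassP u = E.shift → u ∈ L.lattice) : (E.lamOf L u, E.muOf L u) ∈ E.points := by
  by_cases hL : u ∈ L.lattice
  · simp [points, lamOf_of_mem hL, muOf_of_mem hL, U₄_c]
  have h : E.shift - L.weierstrassP u ≠ 0 := sub_ne_zero.2 fun h => hL (hu h.symm)
  change E.muOf L u ^ 2 = E.U₄ (E.lamOf L u)
  rw [muOf_of_notMem hL, lamOf_of_notMem hL, div_pow, mul_pow,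
    derivWeierstrassP_sq_eq hg₂ hg₃ hL, e₁_eq, e₂_eq, e₃_eq, U₄]
  generalize hd : E.shift - L.weierstrassP u = d at h
  obtain hp : L.weierstrassP u = E.shift - d := by rw [← hd]; ring
  rw [hp, mul_pow, Complex.I_sq, branchProd]
  have k₁ : E.c + (E.a₁ - E.c) * (E.a₂ - E.c) * (E.a₃ - E.c) / d - E.a₁ =
      (E.a₁ - E.c) * ((E.a₂ - E.c) * (E.a₃ - E.c) - d) / d := by field_simp; ring
  have k₂ : E.c + (E.a₁ - E.c) * (E.a₂ - E.c) * (E.a₃ - E.c) / d - E.a₂ =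
      (E.a₂ - E.c) * ((E.a₃ - E.c) * (E.a₁ - E.c) - d) / d := by field_simp; ring
  have k₃ : E.c + (E.a₁ - E.c) * (E.a₂ - E.c) * (E.a₃ - E.c) / d - E.a₃ =
      (E.a₃ - E.c) * ((E.a₁ - E.c) * (E.a₂ - E.c) - d) / d := by field_simp; ring
  rw [k₁, k₂, k₃]
  field_simp
  ring

lemma hasDerivAt_lamOf_muOf_of_notMem (hg₂ : L.g₂ = E.g₂) {u : ℂ}
    (hL : u ∉ L.lattice) (h : E.shift - L.weierstrassP u ≠ 0)
    (hsq : L.derivWeierstrassP u ^ 2 =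
      4 * (L.weierstrassP u - E.e₁) * (L.weierstrassP u - E.e₂) * (L.weierstrassP u - E.e₃)) :
    HasDerivAt (E.lamOf L) (-2 * Complex.I * E.muOf L u) u ∧
      HasDerivAt (E.muOf L) (-Complex.I * E.derivU₄ (E.lamOf L u)) u := by
  have hev := L.isOpen_compl_lattice.mem_nhds hL
  have hp := (L.hasDerivAt_weierstrassP hL).const_sub E.shift
  have hp' := L.hasDerivAt_derivWeierstrassP hL
  have hsum : E.e₁ + E.e₂ + E.e₃ = 0 := by simp only [e₁, e₂, e₃]; ring
  constructor
  · have h1 := (((hasDerivAt_const u E.branchProd).div hp h).const_add E.c).congr_of_eventuallyEq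
      (f₁ := E.lamOf L) (by filter_upwards [hev] with z hz using lamOf_of_notMem hz)
    refine h1.congr_deriv ?_
    rw [muOf_of_notMem hL]
    field_simp
    ring_nf
    simp [Complex.I_sq]
  · have h1 := ((hp'.const_mul (Complex.I * E.branchProd)).div ((hp.pow 2).const_mul 2)
      (mul_ne_zero two_ne_zero (pow_ne_zero 2 h))).congr_of_eventuallyEq
      (f₁ := E.muOf L) (by filter_upwards [hev] with z hz using muOf_of_notMem hz)
    refine h1.congr_deriv ?_
    rw [lamOf_of_notMem hL, hg₂, g₂]
    generalize hd : E.shift - L.weierstrassP u = d at h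
    generalize L.derivWeierstrassP u = q at hsq
    obtain hpd : L.weierstrassP u = E.shift - d := by rw [← hd]; ring
    simp only [Pi.pow_apply]
    have k₁ : E.c + E.branchProd / d - E.a₁ =
        (E.a₁ - E.c) * ((E.a₂ - E.c) * (E.a₃ - E.c) - d) / d := by
      rw [branchProd]; field_simp; ring
    have k₂ : E.c + E.branchProd / d - E.a₂ =
        (E.a₂ - E.c) * ((E.a₃ - E.c) * (E.a₁ - E.c) - d) / d := by
      rw [branchProd]; field_simp; ring
    have k₃ : E.c + E.branchProd / d - E.a₃ =
        (E.a₃ - E.c) * ((E.a₁ - E.c) * (E.a₂ - E.c) - d) / d := by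
      rw [branchProd]; field_simp; ring
    rw [derivU₄, k₁, k₂, k₃, add_sub_cancel_left]
    rw [hpd, e₁_eq, e₂_eq, e₃_eq] at hsq
    rw [hpd, e₁_eq, e₂_eq, e₃_eq]
    clear k₁ k₂ k₃ hsum hpd hd hp hp' h1
    rw [shift, branchProd] at *
    generalize E.a₁ - E.c = b₁ at *
    generalize E.a₂ - E.c = b₂ at *
    generalize E.a₃ - E.c = b₃ at *
    push_cast
    field_simp
    linear_combination (324 * b₁ * b₂ * b₃ * d ^ 4) * hsq


lemma eventually_ne_shift (u : ℂ) :
    ∀ᶠ z in 𝓝[≠] u, u ∈ L.lattice → E.shift - L.weierstrassP z ≠ 0 := by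
  by_cases hL : u ∈ L.lattice
  swap
  · simp [hL]
  have hD : ∀ᶠ z in 𝓝 u, E.shift * (z - u) ^ 2 - L.weierstrassPExcept u z * (z - u) ^ 2 - 1 +
      (z - u) ^ 2 * (u ^ 2)⁻¹ ≠ 0 := by
    have hp := L.analyticAt_weierstrassPExcept u
    refine ContinuousAt.eventually_ne (AnalyticAt.continuousAt (𝕜 := ℂ) (by fun_prop)) ?_
    simp
  filter_upwards [self_mem_nhdsWithin, mem_nhdsWithin_of_mem_nhds hD] with z hzu hDz _ h0
  apply hDz
  have hzu : z - u ≠ 0 := sub_ne_zero.2 hzu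
  rw [← L.weierstrassPExcept_add ⟨u, hL⟩] at h0
  have : E.shift * (z - u) ^ 2 - L.weierstrassPExcept u z * (z - u) ^ 2 - 1 +
      (z - u) ^ 2 * (u ^ 2)⁻¹ = (z - u) ^ 2 *
      (E.shift - (L.weierstrassPExcept u z + (1 / (z - u) ^ 2 - 1 / u ^ 2))) := by
    simp only [one_div]
    field_simp
    ring
  rw [this, h0, mul_zero]

lemma eventually_regular {u : ℂ} (hu : L.weierstrassP u = E.shift → u ∈ L.lattice) :
    ∀ᶠ z in 𝓝 u, L.weierstrassP z = E.shift → z ∈ L.lattice := by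
  by_cases hL : u ∈ L.lattice
  · filter_upwards [eventually_nhdsWithin_iff.1 (eventually_ne_shift (E := E) (L := L) u)]
      with z hz hzs
    by_cases hzu : z = u
    · rwa [hzu]
    · exact absurd (by rw [hzs, sub_self]) (hz hzu hL)
  · have h := (L.hasDerivAt_weierstrassP hL).continuousAt.eventually_ne (fun h => hL (hu h))
    filter_upwards [h] with z hz hz' using absurd hz' hz

lemma hasDerivAt_lamOf_muOf (hg₂ : L.g₂ = E.g₂) (hg₃ : L.g₃ = E.g₃) {u : ℂ}
    (hu : L.weierstrassP u = E.shift → u ∈ L.lattice) :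
    HasDerivAt (E.lamOf L) (-2 * Complex.I * E.muOf L u) u ∧
      HasDerivAt (E.muOf L) (-Complex.I * E.derivU₄ (E.lamOf L u)) u := by
  by_cases hL : u ∈ L.lattice
  · obtain ⟨hl, hm⟩ := analyticAt_lamOf_muOf hu
    have hev : ∀ᶠ z in 𝓝[≠] u, HasDerivAt (E.lamOf L) (-2 * Complex.I * E.muOf L z) z ∧
        HasDerivAt (E.muOf L) (-Complex.I * E.derivU₄ (E.lamOf L z)) z := by
      filter_upwards [L.eventually_notMem_lattice u, eventually_ne_shift u] with z hz hzu
      exact hasDerivAt_lamOf_muOf_of_notMem hg₂ hz (hzu hL) (derivWeierstrassP_sq_eq hg₂ hg₃ hz)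
    have key : ∀ {f g : ℂ → ℂ}, AnalyticAt ℂ f u → ContinuousAt g u →
        (∀ᶠ z in 𝓝[≠] u, HasDerivAt f (g z) z) → HasDerivAt f (g u) u := by
      intro f g hf hg h
      refine hf.differentiableAt.hasDerivAt.congr_deriv ?_
      exact ((hf.deriv.continuousAt.eventuallyEq_nhds_iff_eventuallyEq_nhdsNE hg).1
        (h.mono fun z hz => hz.deriv)).eq_of_nhds
    refine ⟨key (g := fun z => -2 * Complex.I * E.muOf L z) hl
      (continuousAt_const.mul hm.continuousAt) (hev.mono fun z hz => hz.1),
      key (g := fun z => -Complex.I * E.derivU₄ (E.lamOf L z)) hm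
      (continuousAt_const.mul ?_) (hev.mono fun z hz => hz.2)⟩
    exact ContinuousAt.comp (g := E.derivU₄) (f := E.lamOf L) E.contDiff_derivU₄.continuous.continuousAt hl.continuousAt
  · exact hasDerivAt_lamOf_muOf_of_notMem hg₂ hL (sub_ne_zero.2 fun h => hL (hu h.symm))
      (derivWeierstrassP_sq_eq hg₂ hg₃ hL)

end QuarticCurve

namespace QuarticCurve

namespace Path

variable {E : QuarticCurve} (γ : E.Path)

open ComplexConjugate

/-- The velocity of the path with respect to the holomorphic differential `dλ / (2 μ)`, which is also
`dμ / U₄'(λ)`. -/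
def velocityAux (t : ℝ) : ℂ :=
  (conj (2 * γ.mu t) * derivWithin γ.lam (Icc 0 1) t +
    conj (E.derivU₄ (γ.lam t)) * derivWithin γ.mu (Icc 0 1) t) /
  (conj (2 * γ.mu t) * (2 * γ.mu t) + conj (E.derivU₄ (γ.lam t)) * E.derivU₄ (γ.lam t))

/-- The velocity of the path with respect to `dλ / (2 μ)`, extended by constants to the real line. -/
def velocity (t : ℝ) : ℂ := γ.velocityAux (projIcc 0 1 zero_le_one t)

lemma velocity_denom_ne_zero {t : ℝ} (ht : t ∈ Icc (0 : ℝ) 1) :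
    conj (2 * γ.mu t) * (2 * γ.mu t) +
      conj (E.derivU₄ (γ.lam t)) * E.derivU₄ (γ.lam t) ≠ 0 := by
  rw [← Complex.normSq_eq_conj_mul_self, ← Complex.normSq_eq_conj_mul_self]
  norm_cast
  have h1 := Complex.normSq_nonneg (2 * γ.mu t)
  have h2 := Complex.normSq_nonneg (E.derivU₄ (γ.lam t))
  intro h
  have h3 : γ.mu t = 0 := by
    have : Complex.normSq (2 * γ.mu t) = 0 := by linarith
    simpa using this
  have h4 : E.derivU₄ (γ.lam t) = 0 := Complex.normSq_eq_zero.1 (by linarith)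
  have h5 := γ.mem_points t ht
  simp only [points, mem_ofPred_eq, h3] at h5
  exact E.derivU₄_ne_zero (by rw [← h5]; simp) h4

lemma velocity_eq {t : ℝ} (ht : t ∈ Icc (0 : ℝ) 1) : γ.velocity t = γ.velocityAux t := by
  rw [velocity, projIcc_of_mem _ ht]

lemma continuous_velocity : Continuous γ.velocity := by
  have hu : UniqueDiffOn ℝ (Icc (0 : ℝ) 1) := uniqueDiffOn_Icc zero_lt_one
  have hl := γ.contDiffOn_lam.continuousOn
  have hm := γ.contDiffOn_mu.continuousOn
  have hl' := γ.contDiffOn_lam.continuousOn_derivWithin hu le_rfl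
  have hm' := γ.contDiffOn_mu.continuousOn_derivWithin hu le_rfl
  have hc : Continuous (conj : ℂ → ℂ) := Complex.continuous_conj
  have hU : ContinuousOn (fun t => E.derivU₄ (γ.lam t)) (Icc 0 1) :=
    E.contDiff_derivU₄.continuous.comp_continuousOn hl
  have h2m : ContinuousOn (fun t => 2 * γ.mu t) (Icc 0 1) := continuousOn_const.mul hm
  have h : ContinuousOn γ.velocityAux (Icc 0 1) :=
    (((hc.comp_continuousOn h2m).mul hl').add ((hc.comp_continuousOn hU).mul hm')).div
      (((hc.comp_continuousOn h2m).mul h2m).add ((hc.comp_continuousOn hU).mul hU))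
      fun t ht => γ.velocity_denom_ne_zero ht
  exact (continuousOn_iff_continuous_domRestrict.1 h).comp continuous_projIcc

lemma hasDerivWithinAt_lam_mu {t : ℝ} (ht : t ∈ Icc (0 : ℝ) 1) :
    HasDerivWithinAt γ.lam (2 * γ.mu t * γ.velocity t) (Icc 0 1) t ∧
      HasDerivWithinAt γ.mu (E.derivU₄ (γ.lam t) * γ.velocity t) (Icc 0 1) t := by
  have hl := (γ.contDiffOn_lam.differentiableOn one_ne_zero t ht).hasDerivWithinAt
  have hm := (γ.contDiffOn_mu.differentiableOn one_ne_zero t ht).hasDerivWithinAt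
  have hD := γ.velocity_denom_ne_zero ht
  have h1 := hm.pow 2
  have h2 := ((E.hasDerivAt_U₄ (γ.lam t)).comp_hasDerivWithinAt t hl).congr_of_mem
    (f₁ := fun t => γ.mu t ^ 2) (fun s hs => γ.mem_points s hs) ht
  have h3 := (uniqueDiffOn_Icc (zero_lt_one (α := ℝ)) t ht).eq_deriv _ h1 h2
  norm_num at h3
  constructor
  · refine hl.congr_deriv ?_
    rw [γ.velocity_eq ht, velocityAux, mul_div_assoc', eq_div_iff hD]
    linear_combination (-conj (E.derivU₄ (γ.lam t))) * h3
  · refine hm.congr_deriv ?_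
    rw [γ.velocity_eq ht, velocityAux, mul_div_assoc', eq_div_iff hD]
    linear_combination (conj (2 * γ.mu t)) * h3

lemma ae_pullback_eq (R : ℂ → ℂ) :
    ∀ᵐ t : ℝ, t ∈ Ioo (0 : ℝ) 1 → γ.pullback R t = R (γ.lam t) * γ.velocity t := by
  have hd : ∀ t ∈ Ioo (0 : ℝ) 1, HasDerivAt γ.lam (2 * γ.mu t * γ.velocity t) t ∧
      HasDerivAt γ.mu (E.derivU₄ (γ.lam t) * γ.velocity t) t := fun t ht =>
    ⟨(γ.hasDerivWithinAt_lam_mu (Ioo_subset_Icc_self ht)).1.hasDerivAt (Icc_mem_nhds ht.1 ht.2),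
      (γ.hasDerivWithinAt_lam_mu (Ioo_subset_Icc_self ht)).2.hasDerivAt (Icc_mem_nhds ht.1 ht.2)⟩
  have hnull : volume {t : ℝ | t ∈ Ioo (0 : ℝ) 1 ∧ γ.mu t = 0 ∧ γ.velocity t ≠ 0} = 0 := by
    refine measure_null_of_locally_null _ fun t ht => ⟨{t}, ?_, by simp⟩
    obtain ⟨ht, hm, hv⟩ := ht
    have hU : E.derivU₄ (γ.lam t) ≠ 0 := by
      have h := γ.mem_points t (Ioo_subset_Icc_self ht)
      simp only [points, mem_ofPred_eq, hm] at h
      exact E.derivU₄_ne_zero (by rw [← h]; simp)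
    have h := eventually_nhdsWithin_iff.1 ((hd t ht).2.eventually_ne (c := 0) (mul_ne_zero hU hv))
    filter_upwards [mem_nhdsWithin_of_mem_nhds h, self_mem_nhdsWithin] with s hs hs'
    by_contra hst
    exact hs hst hs'.2.1
  filter_upwards [compl_mem_ae_iff.2 hnull] with t ht ht'
  rw [pullback, (hd t ht').1.deriv]
  by_cases hm : γ.mu t = 0
  · have : γ.velocity t = 0 := by
      by_contra hv
      exact ht ⟨ht', hm, hv⟩
    simp [this, hm]
  · field_simp

lemma ae_uIoc_pullback_eq (R : ℂ → ℂ) {t : ℝ} (ht : t ∈ Icc (0 : ℝ) 1) :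
    ∀ᵐ s : ℝ, s ∈ uIoc 0 t → γ.pullback R s = R (γ.lam s) * γ.velocity s := by
  have h1 : ∀ᵐ s : ℝ, s ≠ 1 := by simp [ae_iff]
  filter_upwards [γ.ae_pullback_eq R, h1] with s hs hs1 hst
  rw [uIoc_of_le ht.1] at hst
  exact hs ⟨hst.1, lt_of_le_of_ne (hst.2.trans ht.2) hs1⟩

lemma continuousOn_lam : ContinuousOn γ.lam (Icc 0 1) := γ.contDiffOn_lam.continuousOn

lemma intervalIntegrable_pullback {R : ℂ → ℂ}
    (hR : ContinuousOn (fun t => R (γ.lam t)) (Icc 0 1)) :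
    IntervalIntegrable (γ.pullback R) volume 0 1 := by
  have h : IntervalIntegrable (fun t => R (γ.lam t) * γ.velocity t) volume 0 1 := by
    refine ContinuousOn.intervalIntegrable ?_
    rw [uIcc_of_le zero_le_one]
    exact hR.mul γ.continuous_velocity.continuousOn
  refine h.congr_ae ?_
  rw [EventuallyEq, ae_restrict_iff' measurableSet_uIoc]
  filter_upwards [γ.ae_uIoc_pullback_eq R (right_mem_Icc.2 zero_le_one)] with s hs hs'
  exact (hs hs').symm

lemma integral_eq (R : ℂ → ℂ) {t : ℝ} (ht : t ∈ Icc (0 : ℝ) 1) :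
    γ.integral R t = ∫ s in (0 : ℝ)..t, R (γ.lam s) * γ.velocity s :=
  intervalIntegral.integral_congr_ae (γ.ae_uIoc_pullback_eq R ht)

lemma hasDerivWithinAt_integral {R : ℂ → ℂ}
    (hR : ContinuousOn (fun t => R (γ.lam t)) (Icc 0 1)) {t : ℝ} (ht : t ∈ Icc (0 : ℝ) 1) :
    HasDerivWithinAt (γ.integral R) (R (γ.lam t) * γ.velocity t) (Icc 0 1) t := by
  set G : ℝ → ℂ := fun s => R (γ.lam (projIcc 0 1 zero_le_one s)) * γ.velocity s with hG
  have hGc : Continuous G :=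
    ((continuousOn_iff_continuous_domRestrict.1 hR).comp continuous_projIcc).mul
      γ.continuous_velocity
  have hGeq : ∀ s ∈ Icc (0 : ℝ) 1, G s = R (γ.lam s) * γ.velocity s := by
    intro s hs
    simp only [hG, projIcc_of_mem _ hs]
  have h := (hGc.integral_hasStrictDerivAt 0 t).hasDerivAt.hasDerivWithinAt (s := Icc 0 1)
  rw [hGeq t ht] at h
  refine h.congr_of_mem (fun s hs => ?_) ht
  rw [γ.integral_eq R hs]
  refine intervalIntegral.integral_congr fun y hy => ?_
  rw [uIcc_of_le hs.1] at hy
  exact (hGeq y ⟨hy.1, hy.2.trans hs.2⟩).symm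

lemma hasDerivWithinAt_abel {t : ℝ} (ht : t ∈ Icc (0 : ℝ) 1) :
    HasDerivWithinAt γ.abel (Complex.I * γ.velocity t) (Icc 0 1) t := by
  have := (γ.hasDerivWithinAt_integral (R := fun _ => 1) continuousOn_const ht).const_mul Complex.I
  simpa only [one_mul] using! this

lemma continuousOn_abel : ContinuousOn γ.abel (Icc 0 1) :=
  fun _ ht => (γ.hasDerivWithinAt_abel ht).continuousWithinAt

@[simp] lemma integral_zero (R : ℂ → ℂ) : γ.integral R 0 = 0 := by simp [integral]

@[simp] lemma abel_zero : γ.abel 0 = 0 := by simp [abel]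

lemma eqOn_of_regular {L : PeriodPair} (hg₂ : L.g₂ = E.g₂) (hg₃ : L.g₃ = E.g₃) {a b : ℝ}
    (ha : 0 ≤ a) (hb : b ≤ 1)
    (hreg : ∀ t ∈ Icc a b, L.weierstrassP (γ.abel t) = E.shift → γ.abel t ∈ L.lattice)
    (h0 : γ.lam a = E.lamOf L (γ.abel a) ∧ γ.mu a = E.muOf L (γ.abel a)) :
    EqOn (fun t => (γ.lam t, γ.mu t)) (fun t => (E.lamOf L (γ.abel t), E.muOf L (γ.abel t)))
      (Icc a b) := by
  have hsub : Icc a b ⊆ Icc (0 : ℝ) 1 := Icc_subset_Icc ha hb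
  have hf : ContinuousOn (fun t => (γ.lam t, γ.mu t)) (Icc a b) :=
    (γ.contDiffOn_lam.continuousOn.prodMk γ.contDiffOn_mu.continuousOn).mono hsub
  have hab := γ.continuousOn_abel.mono hsub
  have hg : ContinuousOn (fun t => (E.lamOf L (γ.abel t), E.muOf L (γ.abel t))) (Icc a b) :=
    fun t ht => (((analyticAt_lamOf_muOf (hreg t ht)).1.continuousAt.comp_continuousWithinAt
      (hab t ht)).prodMk ((analyticAt_lamOf_muOf (hreg t ht)).2.continuousAt.comp_continuousWithinAt
      (hab t ht)))
  obtain ⟨R, hR⟩ := ((isCompact_Icc.image_of_continuousOn hf).union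
    (isCompact_Icc.image_of_continuousOn hg)).isBounded.subset_closedBall 0
  have hF : ContDiff ℝ 1 fun p : ℂ × ℂ => (2 * p.2, E.derivU₄ p.1) :=
    (contDiff_const.mul contDiff_snd).prodMk (E.contDiff_derivU₄.comp contDiff_fst)
  obtain ⟨K, hK⟩ := LocallyLipschitzOn.exists_lipschitzOnWith_of_compact
    (isCompact_closedBall (0 : ℂ × ℂ) R) hF.locallyLipschitz.locallyLipschitzOn
  obtain ⟨C, hC⟩ := (isCompact_Icc (a := a) (b := b)).exists_bound_of_continuousOn
    γ.continuous_velocity.continuousOn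
  have hmem : ∀ t ∈ Ico a b, Icc (0 : ℝ) 1 ∈ 𝓝[≥] t := fun t ht =>
    mem_nhdsGE_iff_exists_Icc_subset.2 ⟨b, ht.2, Icc_subset_Icc (ha.trans ht.1) hb⟩
  refine ODE_solution_unique_of_mem_Icc_right
    (v := fun t p => γ.velocity t • ((2 * p.2, E.derivU₄ p.1) : ℂ × ℂ))
    (s := fun _ => Metric.closedBall 0 R) (K := C.toNNReal * K) ?_ hf ?_ ?_ hg ?_ ?_ ?_
  · intro t ht
    refine LipschitzOnWith.of_dist_le_mul fun p hp q hq => ?_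
    rw [dist_eq_norm, ← smul_sub, norm_smul, NNReal.coe_mul, mul_assoc, ← dist_eq_norm]
    refine mul_le_mul ?_ (hK.dist_le_mul p hp q hq) dist_nonneg (by positivity)
    exact (hC t (Ico_subset_Icc_self ht)).trans (Real.le_coe_toNNReal C)
  · intro t ht
    obtain ⟨h1, h2⟩ := γ.hasDerivWithinAt_lam_mu (hsub (Ico_subset_Icc_self ht))
    refine ((h1.prodMk h2).mono_of_mem_nhdsWithin (hmem t ht)).congr_deriv ?_
    simp [mul_comm]
  · exact fun t ht => hR (.inl (mem_image_of_mem _ (Ico_subset_Icc_self ht)))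
  · intro t ht
    obtain ⟨h1, h2⟩ := hasDerivAt_lamOf_muOf hg₂ hg₃ (hreg t (Ico_subset_Icc_self ht))
    have h3 := γ.hasDerivWithinAt_abel (hsub (Ico_subset_Icc_self ht))
    refine (((h1.comp_hasDerivWithinAt t h3).prodMk
      (h2.comp_hasDerivWithinAt t h3)).mono_of_mem_nhdsWithin (hmem t ht)).congr_deriv ?_
    simp only [Prod.smul_mk, smul_eq_mul, Prod.mk.injEq]
    constructor
    · linear_combination (-2 * E.muOf L (γ.abel t) * γ.velocity t) * Complex.I_sq
    · linear_combination (-E.derivU₄ (E.lamOf L (γ.abel t)) * γ.velocity t) * Complex.I_sq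
  · exact fun t ht => hR (.inr (mem_image_of_mem _ (Ico_subset_Icc_self ht)))
  · simp only [h0.1, h0.2]

/-- The Abel map is inverted by `lamOf` and `muOf`. -/
theorem eq_lamOf_muOf {L : PeriodPair} (hg₂ : L.g₂ = E.g₂) (hg₃ : L.g₃ = E.g₃) {t : ℝ}
    (ht : t ∈ Icc (0 : ℝ) 1) :
    (L.weierstrassP (γ.abel t) = E.shift → γ.abel t ∈ L.lattice) ∧
      γ.lam t = E.lamOf L (γ.abel t) ∧ γ.mu t = E.muOf L (γ.abel t) := by
  set s : Set ℝ := {t | (L.weierstrassP (γ.abel t) = E.shift → γ.abel t ∈ L.lattice) ∧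
      γ.lam t = E.lamOf L (γ.abel t) ∧ γ.mu t = E.muOf L (γ.abel t)} with hs
  suffices h : Icc (0 : ℝ) 1 ⊆ s from h ht
  refine IsClosed.Icc_subset_of_forall_mem_nhdsWithin ?_ ?_ ?_
  · refine isClosed_of_closure_subset fun x hx => ?_
    have hxI : x ∈ Icc (0 : ℝ) 1 := isClosed_Icc.closure_subset_iff.2 inter_subset_right hx
    have : (𝓝[s ∩ Icc 0 1] x).NeBot := mem_closure_iff_nhdsWithin_neBot.1 hx
    have hle : 𝓝[s ∩ Icc 0 1] x ≤ 𝓝[Icc 0 1] x := nhdsWithin_mono _ inter_subset_right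
    have hmem : ∀ᶠ y in 𝓝[s ∩ Icc 0 1] x, y ∈ s := by
      filter_upwards [self_mem_nhdsWithin] with y hy using hy.1
    have hab : Tendsto γ.abel (𝓝[s ∩ Icc 0 1] x) (𝓝 (γ.abel x)) :=
      (γ.continuousOn_abel x hxI).mono_left hle
    have hlam : Tendsto γ.lam (𝓝[s ∩ Icc 0 1] x) (𝓝 (γ.lam x)) :=
      (γ.continuousOn_lam x hxI).mono_left hle
    have hmu : Tendsto γ.mu (𝓝[s ∩ Icc 0 1] x) (𝓝 (γ.mu x)) :=
      (γ.contDiffOn_mu.continuousOn x hxI).mono_left hle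
    have hreg : L.weierstrassP (γ.abel x) = E.shift → γ.abel x ∈ L.lattice := by
      intro h
      by_contra hL
      have h1 : Tendsto (fun y => (γ.lam y - E.c) * (E.shift - L.weierstrassP (γ.abel y)))
          (𝓝[s ∩ Icc 0 1] x) (𝓝 ((γ.lam x - E.c) * (E.shift - L.weierstrassP (γ.abel x)))) :=
        (hlam.sub_const _).mul (tendsto_const_nhds.sub
          ((L.hasDerivAt_weierstrassP hL).continuousAt.tendsto.comp hab))
      have h2 : ∀ᶠ y in 𝓝[s ∩ Icc 0 1] x,
          (γ.lam y - E.c) * (E.shift - L.weierstrassP (γ.abel y)) = E.branchProd := by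
        filter_upwards [hmem, hab.eventually (L.isOpen_compl_lattice.mem_nhds hL)] with y hy hyL
        rw [hy.2.1, lamOf_of_notMem hyL, add_sub_cancel_left, div_mul_cancel₀]
        exact sub_ne_zero.2 fun h => hyL (hy.1 h.symm)
      have h3 := tendsto_nhds_unique (h1.congr' h2) tendsto_const_nhds
      rw [h, sub_self, mul_zero] at h3
      exact E.branchProd_ne_zero h3.symm
    obtain ⟨hl, hm⟩ := analyticAt_lamOf_muOf hreg
    exact ⟨⟨hreg,
      tendsto_nhds_unique hlam ((hl.continuousAt.tendsto.comp hab).congr'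
        (hmem.mono fun y hy => hy.2.1.symm)),
      tendsto_nhds_unique hmu ((hm.continuousAt.tendsto.comp hab).congr'
        (hmem.mono fun y hy => hy.2.2.symm))⟩, hxI⟩
  · have h0 : (0 : ℂ) ∈ L.lattice := zero_mem _
    simp [hs, lamOf_of_mem h0, muOf_of_mem h0, γ.lam_zero, γ.mu_zero]
  · rintro x ⟨hx, hxI⟩
    have h1 : ∀ᶠ y in 𝓝[≥] x, L.weierstrassP (γ.abel y) = E.shift → γ.abel y ∈ L.lattice := by
      have h2 : Tendsto γ.abel (𝓝[≥] x) (𝓝 (γ.abel x)) :=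
        (γ.continuousOn_abel x (Ico_subset_Icc_self hxI)).mono_left
          (nhdsWithin_le_of_mem (mem_nhdsGE_iff_exists_Icc_subset.2
            ⟨1, hxI.2, Icc_subset_Icc hxI.1 le_rfl⟩))
      exact h2.eventually (eventually_regular hx.1)
    obtain ⟨b, hb, hbs⟩ := mem_nhdsGE_iff_exists_Icc_subset.1
      (inter_mem h1 (mem_nhdsGE_iff_exists_Icc_subset.2 ⟨1, hxI.2, Subset.rfl⟩))
    have hxb : x ≤ b := le_of_lt hb
    have h3 := γ.eqOn_of_regular hg₂ hg₃ hxI.1 (hbs (right_mem_Icc.2 hxb)).2.2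
      (fun t ht => (hbs ht).1) hx.2
    refine mem_nhdsGT_iff_exists_Ioc_subset.2 ⟨b, hb, fun y hy => ?_⟩
    have hy' := Ioc_subset_Icc_self hy
    exact ⟨(hbs hy').1, (Prod.mk.inj (h3 hy')).1, (Prod.mk.inj (h3 hy')).2⟩

end Path

end QuarticCurve

namespace QuarticCurve

variable {E : QuarticCurve} {L : PeriodPair}

/-! ### Paths with prescribed Abel image -/

lemma isAbelImage_zero : E.IsAbelImage (E.c, 0) 0 := by
  refine ⟨⟨fun _ => E.c, fun _ => 0, contDiffOn_const, contDiffOn_const, fun t _ => ?_, rfl, rfl⟩,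
    rfl, ?_⟩
  · simp [points, U₄_c]
  · simp [Path.abel, Path.integral, Path.pullback]

/-- The parabola from `0` to `ω` with bending parameter `y`. -/
def arc (ω : ℂ) (y t : ℝ) : ℂ := ω * (t + Complex.I * y * t * (1 - t))

lemma hasDerivAt_arc (ω : ℂ) (y t : ℝ) :
    HasDerivAt (arc ω y) (ω * (1 + Complex.I * y * (1 - 2 * t))) t := by
  have h : HasDerivAt (fun z : ℂ => ω * (z + Complex.I * y * z * (1 - z)))
      (ω * (1 + Complex.I * y * (1 - 2 * t))) t := by
    have h1 := hasDerivAt_id (t : ℂ)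
    refine ((h1.add ((h1.const_mul (Complex.I * y)).mul (h1.const_sub 1))).const_mul
      ω).congr_deriv ?_
    simp only [id]
    ring
  exact h.comp_ofReal

lemma contDiff_arc (ω : ℂ) (y : ℝ) : ContDiff ℝ 1 (arc ω y) := by
  have : ContDiff ℝ 1 fun t : ℝ => (t : ℂ) := Complex.ofRealCLM.contDiff
  unfold arc
  fun_prop

lemma exists_arc_avoiding {ω : ℂ} (hω : ω ≠ 0) {S : Set ℂ} (hS : S.Countable) (h0 : 0 ∉ S)
    (h1 : ω ∉ S) : ∃ y : ℝ, ∀ t, arc ω y t ∉ S := by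
  obtain ⟨y, hy⟩ := ((hS.image fun s =>
    (s / ω).im / ((s / ω).re * (1 - (s / ω).re))).dense_compl ℝ).nonempty
  refine ⟨y, fun t ht => ?_⟩
  by_cases ht0 : t = 0
  · exact h0 (by simpa [arc, ht0] using ht)
  by_cases ht1 : t = 1
  · exact h1 (by simpa [arc, ht1] using ht)
  refine hy ⟨_, ht, ?_⟩
  have h : arc ω y t / ω = t + Complex.I * y * t * (1 - t) := by
    rw [arc, mul_div_cancel_left₀ _ hω]
  have ht1' : 1 - t ≠ 0 := sub_ne_zero.2 (Ne.symm ht1)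
  simp only [h]
  simp
  field_simp

lemma isAbelImage_of_mem_lattice (hg₂ : L.g₂ = E.g₂) (hg₃ : L.g₃ = E.g₃) {ω : ℂ}
    (hω : ω ∈ L.lattice) : E.IsAbelImage (E.c, 0) ω := by
  rcases eq_or_ne ω 0 with rfl | hω0
  · exact isAbelImage_zero
  obtain ⟨y, hy⟩ := exists_arc_avoiding hω0 (L.countable_weierstrassP_eq E.shift)
    (fun h => h.1 (zero_mem _)) (fun h => h.1 hω)
  have hreg : ∀ t, L.weierstrassP (arc ω y t) = E.shift → arc ω y t ∈ L.lattice := by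
    intro t ht
    by_contra h
    exact hy t ⟨h, ht⟩
  have hd : ∀ {f : ℂ → ℂ} {t : ℝ}, AnalyticAt ℂ f (arc ω y t) →
      ContDiffAt ℝ 1 (fun t => f (arc ω y t)) t := fun hf =>
    (hf.contDiffAt.restrict_scalars ℝ).comp _ (contDiff_arc ω y).contDiffAt
  have harc0 : arc ω y 0 = 0 := by simp [arc]
  have harc1 : arc ω y 1 = ω := by simp [arc]
  have h0 : (0 : ℂ) ∈ L.lattice := zero_mem _
  let γ : E.Path :=
    { lam := fun t => E.lamOf L (arc ω y t)
      mu := fun t => E.muOf L (arc ω y t)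
      contDiffOn_lam := fun t _ => (hd (analyticAt_lamOf_muOf (hreg t)).1).contDiffWithinAt
      contDiffOn_mu := fun t _ => (hd (analyticAt_lamOf_muOf (hreg t)).2).contDiffWithinAt
      mem_points := fun t _ => lamOf_muOf_mem_points hg₂ hg₃ (hreg t)
      lam_zero := by rw [harc0, lamOf_of_mem h0]
      mu_zero := by rw [harc0, muOf_of_mem h0] }
  refine ⟨γ, ?_, ?_⟩
  · simp [Path.endpoint, γ, harc1, lamOf_of_mem hω, muOf_of_mem hω]
  have hvel : ∀ t ∈ Icc (0 : ℝ) 1,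
      Complex.I * γ.velocity t = ω * (1 + Complex.I * y * (1 - 2 * t)) := by
    intro t ht
    obtain ⟨h1, h2⟩ := γ.hasDerivWithinAt_lam_mu ht
    obtain ⟨h3, h4⟩ := hasDerivAt_lamOf_muOf hg₂ hg₃ (hreg t)
    have hu := uniqueDiffOn_Icc (zero_lt_one (α := ℝ)) t ht
    have h5 := hu.eq_deriv _ h1 (h3.comp_of_eq t (hasDerivAt_arc ω y t) rfl).hasDerivWithinAt
    have h6 := hu.eq_deriv _ h2 (h4.comp_of_eq t (hasDerivAt_arc ω y t) rfl).hasDerivWithinAt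
    by_cases hm : E.muOf L (arc ω y t) = 0
    · have hU : E.derivU₄ (E.lamOf L (arc ω y t)) ≠ 0 := by
        have h := lamOf_muOf_mem_points hg₂ hg₃ (hreg t)
        simp only [points, mem_ofPred_eq, hm] at h
        exact E.derivU₄_ne_zero (by rw [← h]; simp)
      refine mul_left_cancel₀ hU ?_
      change E.derivU₄ (E.lamOf L (arc ω y t)) * γ.velocity t = _ at h6
      linear_combination Complex.I * h6 - E.derivU₄ (E.lamOf L (arc ω y t)) *
        (ω * (1 + Complex.I * y * (1 - 2 * t))) * Complex.I_sq
    · refine mul_left_cancel₀ hm ?_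
      change 2 * E.muOf L (arc ω y t) * γ.velocity t = _ at h5
      linear_combination Complex.I / 2 * h5 - E.muOf L (arc ω y t) *
        (ω * (1 + Complex.I * y * (1 - 2 * t))) * Complex.I_sq
  have hdiff : ∀ t ∈ Icc (0 : ℝ) 1,
      HasDerivWithinAt (fun t => γ.abel t - arc ω y t) 0 (Icc 0 1) t := by
    intro t ht
    refine ((γ.hasDerivWithinAt_abel ht).sub (hasDerivAt_arc ω y t).hasDerivWithinAt).congr_deriv ?_
    rw [hvel t ht, sub_self]
  have := constant_of_derivWithin_zero (fun t ht => (hdiff t ht).differentiableWithinAt)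
    (fun t ht => (hdiff t (Ico_subset_Icc_self ht)).derivWithin
      (uniqueDiffOn_Icc (zero_lt_one (α := ℝ)) t (Ico_subset_Icc_self ht))) 1
    (right_mem_Icc.2 zero_le_one)
  rw [harc0, harc1, γ.abel_zero, sub_zero, sub_eq_zero] at this
  exact this

lemma IsAbelImage.eq_lamOf_muOf (hg₂ : L.g₂ = E.g₂) (hg₃ : L.g₃ = E.g₃) {p : ℂ × ℂ} {u : ℂ}
    (h : E.IsAbelImage p u) : (L.weierstrassP u = E.shift → u ∈ L.lattice) ∧
      E.lamOf L u = p.1 ∧ E.muOf L u = p.2 := by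
  obtain ⟨γ, rfl, rfl⟩ := h
  obtain ⟨h1, h2, h3⟩ := γ.eq_lamOf_muOf hg₂ hg₃ (right_mem_Icc.2 zero_le_one)
  exact ⟨h1, h2.symm, h3.symm⟩

/-! ### The differential of the third kind -/

lemma lamOf_add {u l : ℂ} (hl : l ∈ L.lattice) : E.lamOf L (u + l) = E.lamOf L u := by
  by_cases h : u ∈ L.lattice
  · rw [lamOf_of_mem h, lamOf_of_mem (add_mem h hl)]
  · rw [lamOf_of_notMem h, lamOf_of_notMem (L.add_notMem_lattice h hl),
      L.weierstrassP_add_coe u ⟨l, hl⟩]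

lemma lamOf_neg (u : ℂ) : E.lamOf L (-u) = E.lamOf L u := by
  by_cases h : u ∈ L.lattice
  · rw [lamOf_of_mem h, lamOf_of_mem (neg_mem h)]
  · rw [lamOf_of_notMem h, lamOf_of_notMem (L.neg_notMem_lattice h), L.weierstrassP_neg]

lemma notMem_lattice_of_lamOf_ne {u w : ℂ} (h : E.lamOf L u ≠ E.lamOf L w) :
    u - w ∉ L.lattice ∧ u + w ∉ L.lattice := by
  constructor
  · intro hl
    apply h
    rw [← lamOf_add (u := w) hl, add_sub_cancel]
  · intro hl
    apply h
    rw [← lamOf_neg w, ← lamOf_add (u := -w) hl]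
    congr 1
    ring

lemma weierstrassP_sub_eq {u w : ℂ} (hu : L.weierstrassP u = E.shift → u ∈ L.lattice)
    (hw : L.weierstrassP w = E.shift → w ∈ L.lattice) (huL : u ∉ L.lattice) (hwL : w ∉ L.lattice) :
    L.weierstrassP u - L.weierstrassP w = E.branchProd * (E.lamOf L u - E.lamOf L w) /
      ((E.lamOf L u - E.c) * (E.lamOf L w - E.c)) := by
  have h1 : E.lamOf L u - E.c ≠ 0 := sub_ne_zero.2 (mt (lamOf_eq_c_iff hu).1 huL)
  have h2 : E.lamOf L w - E.c ≠ 0 := sub_ne_zero.2 (mt (lamOf_eq_c_iff hw).1 hwL)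
  rw [weierstrassP_eq hu huL, weierstrassP_eq hw hwL]
  field_simp
  ring

lemma zeta_eq_of_lamOf_ne {u w : ℂ} (hu : L.weierstrassP u = E.shift → u ∈ L.lattice)
    (hw : L.weierstrassP w = E.shift → w ∈ L.lattice) (hwL : w ∉ L.lattice)
    (h : E.lamOf L u ≠ E.lamOf L w) :
    weierstrassZeta L (u - w) - weierstrassZeta L (u + w) + 2 * weierstrassZeta L w =
      -Complex.I * (2 * E.muOf L w * (1 / (E.lamOf L u - E.lamOf L w) -
        1 / (E.c - E.lamOf L w))) := by
  by_cases huL : u ∈ L.lattice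
  · obtain ⟨η, hη⟩ := L.exists_weierstrassZeta_add huL
    rw [lamOf_of_mem huL, sub_self, mul_zero, mul_zero, show u - w = -w + u by ring, add_comm u w,
      hη _ (L.neg_notMem_lattice hwL), hη _ hwL, L.weierstrassZeta_neg]
    ring
  · obtain ⟨h1, h2⟩ := notMem_lattice_of_lamOf_ne h
    have h3 := L.derivWeierstrassP_eq_mul_zeta huL hwL h1 h2
    have hne : E.lamOf L u - E.lamOf L w ≠ 0 := sub_ne_zero.2 h
    have huc : E.lamOf L u - E.c ≠ 0 := sub_ne_zero.2 (mt (lamOf_eq_c_iff hu).1 huL)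
    have hwc : E.lamOf L w - E.c ≠ 0 := sub_ne_zero.2 (mt (lamOf_eq_c_iff hw).1 hwL)
    have hcw : E.c - E.lamOf L w ≠ 0 := by rw [← neg_sub]; exact neg_ne_zero.2 hwc
    have hB := E.branchProd_ne_zero
    rw [weierstrassP_sub_eq hu hw huL hwL, derivWeierstrassP_eq hw hwL] at h3
    have h4 : E.branchProd * (E.lamOf L u - E.lamOf L w) /
      ((E.lamOf L u - E.c) * (E.lamOf L w - E.c)) ≠ 0 := by positivity
    refine mul_left_cancel₀ h4 ?_
    rw [← h3]
    field_simp
    ring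

lemma HasSimplePoleResidue.eval_eq {K Q : ℂ[X]} {x m ρ : ℂ}
    (h : E.HasSimplePoleResidue (fun q => K.eval q.1 / Q.eval q.1 / (2 * q.2)) (x, m) ρ)
    (hQ : Q.eval x = 0) (hQ' : Q.derivative.eval x ≠ 0) :
    K.eval x = ρ * (2 * m * Q.derivative.eval x) := by
  obtain ⟨hp, hm, -, hlim⟩ := h
  simp only at hm hlim
  have hp : m ^ 2 = E.U₄ x := hp
  set s : ℂ → ℂ := fun y => m * (E.U₄ y / m ^ 2) ^ (((2 : ℕ) : ℂ)⁻¹) with hs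
  have hsq : ∀ y, s y ^ 2 = E.U₄ y := by
    intro y
    rw [hs, mul_pow, Complex.cpow_nat_inv_pow _ two_ne_zero]
    field_simp
  have hsx : s x = m := by
    simp only [hs, ← hp]
    rw [div_self (pow_ne_zero 2 hm), Complex.one_cpow, mul_one]
  have hsc : ContinuousAt s x := by
    refine continuousAt_const.mul (ContinuousAt.cpow ?_ continuousAt_const ?_)
    · exact (E.hasDerivAt_U₄ x).continuousAt.div_const _
    · rw [← hp, div_self (pow_ne_zero 2 hm)]
      exact Complex.one_mem_slitPlane
  have hcurve : Tendsto (fun y => (y, s y)) (𝓝[≠] x) (𝓝[E.points \ {(x, m)}] (x, m)) := by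
    refine tendsto_nhdsWithin_iff.2 ⟨?_, ?_⟩
    · have : ContinuousAt (fun y => (y, s y)) x := continuousAt_id.prodMk hsc
      rw [ContinuousAt, hsx] at this
      exact this.mono_left nhdsWithin_le_nhds
    · filter_upwards [self_mem_nhdsWithin] with y hy
      exact ⟨hsq y, fun h => hy (Prod.mk.inj h).1⟩
  have h1 := hlim.comp hcurve
  have h2 : Tendsto (slope (fun y => Q.eval y) x) (𝓝[≠] x) (𝓝 (Q.derivative.eval x)) :=
    hasDerivAt_iff_tendsto_slope.1 (Q.hasDerivAt x)
  have h3 : Tendsto s (𝓝[≠] x) (𝓝 m) := by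
    rw [ContinuousAt, hsx] at hsc
    exact hsc.mono_left nhdsWithin_le_nhds
  have h4 : Tendsto (fun y => K.eval y) (𝓝[≠] x) (𝓝 (K.eval x)) :=
    K.continuous.continuousAt.tendsto.mono_left nhdsWithin_le_nhds
  have h5 := h1.mul ((h3.const_mul 2).mul h2)
  refine tendsto_nhds_unique (h4.congr' ?_) h5
  filter_upwards [self_mem_nhdsWithin, h2.eventually_ne hQ', h3.eventually_ne hm] with y hy hy2 hy3
  have hyx : y - x ≠ 0 := sub_ne_zero.2 hy
  rw [slope_def_field, hQ, sub_zero] at hy2 ⊢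
  have hQy : Q.eval y ≠ 0 := fun h => hy2 (by rw [h, zero_div])
  simp only [Function.comp]
  field_simp

end QuarticCurve

open Lagrange in
lemma eval_derivative_C_mul_prod_X_sub_C {k : ℕ} (r₀ : ℂ) (r : Fin k → ℂ) (j : Fin k) :
    (C r₀ * ∏ i, (X - C (r i))).derivative.eval (r j) =
      r₀ * (nodal (Finset.univ.erase j) r).eval (r j) := by
  rw [derivative_C_mul, eval_mul, eval_C]
  congr 1
  exact eval_nodal_derivative_eval_node_eq (Finset.mem_univ j)

open Lagrange in
lemma eval_nodal_erase_ne_zero {k : ℕ} {r : Fin k → ℂ} (hr : Function.Injective r) (j : Fin k) :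
    (nodal (Finset.univ.erase j) r).eval (r j) ≠ 0 := by
  rw [eval_nodal, Finset.prod_ne_zero_iff]
  intro i hi
  exact sub_ne_zero.2 (hr.ne (Finset.ne_of_mem_erase hi).symm)

open Lagrange in
/-- Partial fraction decomposition of `K / Q`, for `Q` with simple roots and `K` of degree at most
the degree of `Q`. -/
lemma eval_div_eval_sub_eq_sum {k : ℕ} {K Q : ℂ[X]} (hK : K.natDegree ≤ k) {r₀ : ℂ} (hr₀ : r₀ ≠ 0)
    {r : Fin k → ℂ} (hr : Function.Injective r) (hQ : Q = C r₀ * ∏ j, (X - C (r j)))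
    {ρ : Fin k → ℂ} (hρ : ∀ j, K.eval (r j) = ρ j * Q.derivative.eval (r j)) {c x : ℂ}
    (hc : ∀ j, c ≠ r j) (hx : ∀ j, x ≠ r j) :
    K.eval x / Q.eval x - K.eval c / Q.eval c =
      ∑ j, ρ j * (1 / (x - r j) - 1 / (c - r j)) := by
  classical
  have hQn : Q = C r₀ * nodal Finset.univ r := hQ
  have hQne : ∀ y, (∀ j, y ≠ r j) → Q.eval y ≠ 0 := by
    intro y hy
    rw [hQn, eval_mul, eval_C, eval_nodal]
    exact mul_ne_zero hr₀ (Finset.prod_ne_zero_iff.2 fun j _ => sub_ne_zero.2 (hy j))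
  have herase : ∀ y j, y ≠ r j →
      r₀ * (nodal (Finset.univ.erase j) r).eval y = Q.eval y / (y - r j) := by
    intro y j hy
    rw [eq_div_iff (sub_ne_zero.2 hy), hQn, nodal_eq_mul_nodal_erase (Finset.mem_univ j)]
    simp
    ring
  set κ := K.eval c / Q.eval c - ∑ j, ρ j / (c - r j) with hκ
  set F : ℂ[X] := K - C κ * Q - ∑ j, C (ρ j * r₀) * nodal (Finset.univ.erase j) r with hF
  have hFeval : ∀ y, (∀ j, y ≠ r j) →
      F.eval y = Q.eval y * (K.eval y / Q.eval y - κ - ∑ j, ρ j / (y - r j)) := by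
    intro y hy
    have := hQne y hy
    simp only [hF, eval_sub, eval_mul, eval_C, eval_finsetSum, mul_assoc]
    rw [Finset.sum_congr rfl fun j _ => by rw [herase y j (hy j)]]
    rw [mul_sub, mul_sub, mul_div_cancel₀ _ this, Finset.mul_sum]
    congr 1
    · ring
    · exact Finset.sum_congr rfl fun j _ => by ring
  have hF0 : F = 0 := by
    refine eq_zero_of_natDegree_lt_card_of_eval_eq_zero' F (insert c (Finset.univ.image r)) ?_ ?_
    · intro y hy
      rcases Finset.mem_insert.1 hy with rfl | hy
      · rw [hFeval _ hc, hκ]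
        ring
      · obtain ⟨j, -, rfl⟩ := Finset.mem_image.1 hy
        have hQj : Q.eval (r j) = 0 := by
          rw [hQn, eval_mul, eval_nodal_at_node (Finset.mem_univ j), mul_zero]
        simp only [hF, eval_sub, eval_mul, eval_C, eval_finsetSum, hQj, hρ j]
        rw [Finset.sum_eq_single j, hQ, eval_derivative_C_mul_prod_X_sub_C]
        · ring
        · intro i _ hij
          rw [eval_nodal_at_node (Finset.mem_erase.2 ⟨hij.symm, Finset.mem_univ j⟩), mul_zero]
        · simp
    · rw [Finset.card_insert_of_notMem (by simpa using fun j h => hc j h.symm),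
        Finset.card_image_of_injective _ hr, Finset.card_univ, Fintype.card_fin, Nat.lt_succ_iff]
      have hQd : Q.natDegree ≤ k := by
        rw [hQn]
        refine (natDegree_C_mul_le _ _).trans ?_
        rw [natDegree_nodal]
        simp
      refine (natDegree_sub_le_of_le (natDegree_sub_le_of_le hK
        ((natDegree_C_mul_le _ _).trans hQd)) (natDegree_sum_le_of_forall_le (n := k) _ _ fun j _ =>
          (natDegree_C_mul_le _ _).trans ?_)).trans (by simp)
      rw [natDegree_nodal]
      exact (Finset.card_le_univ _).trans (by simp)
  have h := hFeval x hx
  rw [hF0, eval_zero, eq_comm, mul_eq_zero, or_iff_right (hQne x hx), hκ] at h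
  simp only [mul_sub, Finset.sum_sub_distrib, mul_one_div]
  linear_combination h

lemma HasDerivWithinAt.prod_of_logDeriv {ι : Type*} (s : Finset ι) {q : ι → ℝ → ℂ} {d : ι → ℂ}
    {T : Set ℝ} {t : ℝ} (h : ∀ i ∈ s, HasDerivWithinAt (q i) (d i * q i t) T t) :
    HasDerivWithinAt (fun t => ∏ i ∈ s, q i t) ((∑ i ∈ s, d i) * ∏ i ∈ s, q i t) T t := by
  classical
  induction s using Finset.induction_on with
  | empty => simpa using hasDerivWithinAt_const t T (1 : ℂ)
  | insert a s ha ih =>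
    simp only [Finset.prod_insert ha, Finset.sum_insert ha]
    refine ((h a (Finset.mem_insert_self a s)).mul
      (ih fun i hi => h i (Finset.mem_insert_of_mem hi))).congr_deriv ?_
    ring

namespace QuarticCurve

variable {E : QuarticCurve} {L : PeriodPair}

/-- The quotient of sigma functions is a primitive exponential of the differential of the third
kind. -/
lemma Path.exists_log_sigma_quotient (hg₂ : L.g₂ = E.g₂) (hg₃ : L.g₃ = E.g₃) {k : ℕ} (hk : Odd k)
    {R : ℂ → ℂ} {r m w : Fin k → ℂ} (hrc : ∀ j, r j ≠ E.c)
    (hw : ∀ j, E.IsAbelImage (r j, m j) (w j)) {κ : ℂ}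
    (hR : ∀ x, (∀ j, x ≠ r j) → R x - κ =
      ∑ j, 2 * m j * (1 / (x - r j) - 1 / (E.c - r j)))
    (γ : E.Path) (hRγ : ContinuousOn (fun t => R (γ.lam t)) (Icc 0 1))
    (hγ : ∀ t ∈ Icc (0 : ℝ) 1, ∀ j, γ.lam t ≠ r j) :
    ∃ ℓ : ℝ → ℂ, ContinuousOn ℓ (Icc 0 1) ∧ ℓ 0 = Real.pi * Complex.I ∧
      ∀ t ∈ Icc (0 : ℝ) 1,
        (∏ j, weierstrassSigma L (γ.abel t + w j) ≠ 0) ∧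
        Complex.exp (ℓ t) = (∏ j, weierstrassSigma L (γ.abel t - w j)) /
          (∏ j, weierstrassSigma L (γ.abel t + w j)) ∧
        γ.integral R t =
          ℓ t + 2 * (∑ j, weierstrassZeta L (w j)) * γ.abel t
            + (-Complex.I * κ) * γ.abel t - Real.pi * Complex.I := by
  have hwr : ∀ j, (L.weierstrassP (w j) = E.shift → w j ∈ L.lattice) ∧ E.lamOf L (w j) = r j ∧
      E.muOf L (w j) = m j := fun j => (hw j).eq_lamOf_muOf hg₂ hg₃
  have hwL : ∀ j, w j ∉ L.lattice := fun j h => hrc j (by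
    rw [← (hwr j).2.1, lamOf_of_mem h])
  have hne : ∀ t ∈ Icc (0 : ℝ) 1, ∀ j, γ.abel t - w j ∉ L.lattice ∧ γ.abel t + w j ∉ L.lattice := by
    intro t ht j
    refine notMem_lattice_of_lamOf_ne (E := E) ?_
    rw [← (γ.eq_lamOf_muOf hg₂ hg₃ ht).2.1, (hwr j).2.1]
    exact hγ t ht j
  set ℓ : ℝ → ℂ := fun t => γ.integral R t - (2 * (∑ j, weierstrassZeta L (w j)) +
    -Complex.I * κ) * γ.abel t + Real.pi * Complex.I with hℓ
  have hℓd : ∀ t ∈ Icc (0 : ℝ) 1, HasDerivWithinAt ℓ ((∑ j, (weierstrassZeta L (γ.abel t - w j) -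
      weierstrassZeta L (γ.abel t + w j))) * (Complex.I * γ.velocity t)) (Icc 0 1) t := by
    intro t ht
    refine (((γ.hasDerivWithinAt_integral hRγ ht).sub
      ((γ.hasDerivWithinAt_abel ht).const_mul _)).add_const _).congr_deriv ?_
    obtain ⟨h1, h2, -⟩ := γ.eq_lamOf_muOf hg₂ hg₃ ht
    have h3 : ∑ j, (weierstrassZeta L (γ.abel t - w j) - weierstrassZeta L (γ.abel t + w j) +
        2 * weierstrassZeta L (w j)) = -Complex.I * (R (γ.lam t) - κ) := by
      rw [hR _ (hγ t ht), Finset.mul_sum]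
      refine Finset.sum_congr rfl fun j _ => ?_
      rw [zeta_eq_of_lamOf_ne h1 (hwr j).1 (hwL j)
        (by rw [← h2, (hwr j).2.1]; exact hγ t ht j), ← h2, (hwr j).2.1, (hwr j).2.2]
    rw [Finset.sum_add_distrib, ← Finset.mul_sum] at h3
    linear_combination (-Complex.I * γ.velocity t) * h3 +
      (R (γ.lam t)) * γ.velocity t * Complex.I_sq
  set q : Fin k → ℝ → ℂ := fun j t =>
    weierstrassSigma L (γ.abel t - w j) / weierstrassSigma L (γ.abel t + w j) with hq
  have hqd : ∀ t ∈ Icc (0 : ℝ) 1, ∀ j, HasDerivWithinAt (q j)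
      ((weierstrassZeta L (γ.abel t - w j) - weierstrassZeta L (γ.abel t + w j)) *
        (Complex.I * γ.velocity t) * q j t) (Icc 0 1) t := by
    intro t ht j
    obtain ⟨h1, h2⟩ := hne t ht j
    have h0 := mt L.weierstrassSigma_eq_zero_iff.1 h2
    have d := γ.hasDerivWithinAt_abel ht
    have d1 := (L.hasDerivAt_weierstrassSigma h1).comp_hasDerivWithinAt t (d.sub_const (w j))
    have d2 := (L.hasDerivAt_weierstrassSigma h2).comp_hasDerivWithinAt t (d.add_const (w j))
    refine (d1.div d2 h0).congr_deriv ?_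
    simp only [Function.comp, hq]
    field_simp
  have hΦ : ∀ t ∈ Icc (0 : ℝ) 1,
      HasDerivWithinAt (fun t => Complex.exp (-ℓ t) * ∏ j, q j t) 0 (Icc 0 1) t := by
    intro t ht
    have d := (hℓd t ht).neg.cexp.mul
      (HasDerivWithinAt.prod_of_logDeriv Finset.univ fun j _ => hqd t ht j)
    refine d.congr_deriv ?_
    rw [← Finset.sum_mul]
    simp only [Pi.neg_apply]
    ring
  have hℓ0 : ℓ 0 = Real.pi * Complex.I := by simp [hℓ]
  have hΦ0 : Complex.exp (-ℓ 0) * ∏ j, q j 0 = 1 := by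
    have h1 : ∀ j, q j 0 = -1 := by
      intro j
      simp only [hq, Path.abel_zero, zero_sub, zero_add, L.weierstrassSigma_neg]
      exact neg_div_self (mt L.weierstrassSigma_eq_zero_iff.1 (hwL j))
    rw [Finset.prod_congr rfl fun j _ => h1 j, Finset.prod_const, Finset.card_univ,
      Fintype.card_fin, hk.neg_one_pow, hℓ0, Complex.exp_neg, Complex.exp_pi_mul_I]
    norm_num
  refine ⟨ℓ, fun t ht => (hℓd t ht).continuousWithinAt, hℓ0, fun t ht => ⟨?_, ?_, ?_⟩⟩
  · exact Finset.prod_ne_zero_iff.2 fun j _ => mt L.weierstrassSigma_eq_zero_iff.1 (hne t ht j).2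
  · have h := constant_of_derivWithin_zero (fun t ht => (hΦ t ht).differentiableWithinAt)
      (fun t ht => (hΦ t (Ico_subset_Icc_self ht)).derivWithin
        (uniqueDiffOn_Icc (zero_lt_one (α := ℝ)) t (Ico_subset_Icc_self ht))) t ht
    rw [hΦ0, Complex.exp_neg, inv_mul_eq_one₀ (Complex.exp_ne_zero _)] at h
    rw [h, hq, Finset.prod_div_distrib]
  · simp only [hℓ]
    ring

/-- The squared form of the sigma representation of `∏ (λ - r j) / (λ - c) ^ k`. -/
lemma exists_prod_sub_div_eq_sigma {k : ℕ} {w : Fin k → ℂ}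
    (hw : ∀ j, L.weierstrassP (w j) = E.shift → w j ∈ L.lattice) (hwL : ∀ j, w j ∉ L.lattice) :
    ∃ A : ℂ, A ≠ 0 ∧ ∀ u ∉ L.lattice, (L.weierstrassP u = E.shift → u ∈ L.lattice) →
      (∏ j, (E.lamOf L u - E.lamOf L (w j))) / (E.lamOf L u - E.c) ^ k =
        A ^ 2 * ((∏ j, weierstrassSigma L (u - w j)) * (∏ j, weierstrassSigma L (u + w j)) /
          weierstrassSigma L u ^ (2 * k)) := by
  have hσ : ∀ j, weierstrassSigma L (w j) ≠ 0 := fun j => mt L.weierstrassSigma_eq_zero_iff.1 (hwL j)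
  have hwc : ∀ j, E.lamOf L (w j) - E.c ≠ 0 := fun j =>
    sub_ne_zero.2 (mt (lamOf_eq_c_iff (hw j)).1 (hwL j))
  have hB := E.branchProd_ne_zero
  set P : ℂ := ∏ j, -((E.lamOf L (w j) - E.c) / (E.branchProd * weierstrassSigma L (w j) ^ 2)) with hP
  have hP0 : P ≠ 0 := Finset.prod_ne_zero_iff.2 fun j _ =>
    neg_ne_zero.2 (div_ne_zero (hwc j) (mul_ne_zero hB (pow_ne_zero 2 (hσ j))))
  obtain ⟨A, hA⟩ := IsAlgClosed.exists_pow_nat_eq P zero_lt_two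
  refine ⟨A, fun h => hP0 (by rw [← hA, h]; simp), fun u huL hu => ?_⟩
  have huc : E.lamOf L u - E.c ≠ 0 := sub_ne_zero.2 (mt (lamOf_eq_c_iff hu).1 huL)
  have hσu : weierstrassSigma L u ≠ 0 := mt L.weierstrassSigma_eq_zero_iff.1 huL
  have hj : ∀ j, (E.lamOf L u - E.lamOf L (w j)) / (E.lamOf L u - E.c) =
      -((E.lamOf L (w j) - E.c) / (E.branchProd * weierstrassSigma L (w j) ^ 2)) *
        (weierstrassSigma L (u - w j) * weierstrassSigma L (u + w j) /
          weierstrassSigma L u ^ 2) := by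
    intro j
    have h1 := weierstrassP_sub_eq hu (hw j) huL (hwL j)
    rw [L.weierstrassP_sub_weierstrassP huL (hwL j)] at h1
    have h2 := hwc j
    have h3 := hσ j
    have h4 : (E.lamOf L u - E.lamOf L (w j)) / (E.lamOf L u - E.c) =
        (E.lamOf L (w j) - E.c) / E.branchProd * (E.branchProd *
          (E.lamOf L u - E.lamOf L (w j)) / ((E.lamOf L u - E.c) * (E.lamOf L (w j) - E.c))) := by
      field_simp
    rw [h4, ← h1]
    field_simp
  have hpow : ∀ x : ℂ, x ^ k = ∏ _j : Fin k, x := fun x => by simp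
  rw [hA, hP, pow_mul, hpow (E.lamOf L u - E.c), hpow (weierstrassSigma L u ^ 2),
    ← Finset.prod_div_distrib, ← Finset.prod_mul_distrib, ← Finset.prod_div_distrib,
    ← Finset.prod_mul_distrib]
  exact Finset.prod_congr rfl fun j _ => hj j

end QuarticCurve

/-- Continuous square roots of proportional functions are proportional with a constant sign. -/
lemma exists_sign_of_sq_eq {T : Set ℝ} (hT : IsPreconnected T) {A : ℂ} {p q : ℝ → ℂ}
    (hp : ContinuousOn p T) (hq : ContinuousOn q T) (h : ∀ t ∈ T, p t ^ 2 = (A * q t) ^ 2)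
    (hp0 : ∀ t ∈ T, p t ≠ 0) :
    ∃ B : ℂ, (B = A ∨ B = -A) ∧ ∀ t ∈ T, p t = B * q t := by
  have hq0 : ∀ {t}, t ∈ T → A * q t ≠ 0 := by
    intro t ht h0
    have := h t ht
    rw [h0, zero_pow two_ne_zero, sq_eq_zero_iff] at this
    exact hp0 t ht this
  rcases hT.eq_or_eq_neg_of_sq_eq hp (continuousOn_const.mul hq) h hq0 with h | h
  · exact ⟨A, .inl rfl, h⟩
  · exact ⟨-A, .inr rfl, fun t ht => by rw [h ht]; simp⟩

end

theorem mainTheorem7 (E : QuarticCurve)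
    -- the period lattice of the Weierstrass functions belonging to the curve
    (L : PeriodPair) (hg₂ : L.g₂ = E.g₂) (hg₃ : L.g₃ = E.g₃)
    -- the differential `W = K / Q * dλ / (2 μ)`
    (k : ℕ) (hk : Odd k) (K Q : ℂ[X]) (hK : K.natDegree ≤ k)
    (r₀ : ℂ) (hr₀ : r₀ ≠ 0) (r : Fin k → ℂ) (hr : Function.Injective r)
    (hQ : Q = C r₀ * ∏ j, (X - C (r j)))
    -- its poles `(r j, ± m j)` with residues `± 1`
    (m : Fin k → ℂ)
    (hres_pos : ∀ j, E.HasSimplePoleResidue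
      (fun q => K.eval q.1 / Q.eval q.1 / (2 * q.2)) (r j, m j) 1)
    (hres_neg : ∀ j, E.HasSimplePoleResidue
      (fun q => K.eval q.1 / Q.eval q.1 / (2 * q.2)) (r j, -m j) (-1))
    -- the Abel images of the poles with residue `1`
    (w : Fin k → ℂ) (hw : ∀ j, E.IsAbelImage (r j, m j) (w j)) :
    -- the lattice is the lattice of all periods of `i dλ / (2 μ)`
    (∀ ω : ℂ, ω ∈ L.lattice ↔ E.IsAbelImage (E.c, 0) ω) ∧
    (∀ γ : E.Path, IntervalIntegrable (γ.pullback fun _ => 1) volume 0 1) ∧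
    -- the integral of `W`; `ℓ` is the logarithm continued along the path
    (∀ γ : E.Path, (∀ t ∈ Icc (0 : ℝ) 1, Q.eval (γ.lam t) ≠ 0) →
      IntervalIntegrable (γ.pullback fun x => K.eval x / Q.eval x) volume 0 1 ∧
      ∃ ℓ : ℝ → ℂ, ContinuousOn ℓ (Icc 0 1) ∧ ℓ 0 = Real.pi * Complex.I ∧
        ∀ t ∈ Icc (0 : ℝ) 1,
          (∏ j, weierstrassSigma L (γ.abel t + w j) ≠ 0) ∧
          Complex.exp (ℓ t) = (∏ j, weierstrassSigma L (γ.abel t - w j)) /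
            (∏ j, weierstrassSigma L (γ.abel t + w j)) ∧
          γ.integral (fun x => K.eval x / Q.eval x) t =
            ℓ t + 2 * (∑ j, weierstrassZeta L (w j)) * γ.abel t
              + (-Complex.I * (K.eval E.c / Q.eval E.c)) * γ.abel t - Real.pi * Complex.I) ∧
    -- the square root of `∏ (λ - r j) / (λ - c) ^ k`
    (∃ A : ℂ, A ≠ 0 ∧ ∀ γ : E.Path,
      (∀ t ∈ Icc (0 : ℝ) 1, γ.lam t ≠ E.c →
        weierstrassSigma L (γ.abel t) ≠ 0 ∧
        (∏ j, (γ.lam t - r j)) / (γ.lam t - E.c) ^ k =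
          A ^ 2 * ((∏ j, weierstrassSigma L (γ.abel t - w j)) *
            (∏ j, weierstrassSigma L (γ.abel t + w j)) /
              weierstrassSigma L (γ.abel t) ^ (2 * k))) ∧
      ∀ T : Set ℝ, T ⊆ Icc 0 1 → IsPreconnected T →
        (∀ t ∈ T, γ.lam t ≠ E.c ∧ Q.eval (γ.lam t) ≠ 0) →
        ∀ f g s : ℝ → ℂ, ContinuousOn f T → ContinuousOn g T → ContinuousOn s T →
          (∀ t ∈ T, f t ^ 2 = ∏ j, (γ.lam t - r j)) →
          (∀ t ∈ T, g t ^ 2 = (γ.lam t - E.c) ^ k) →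
          (∀ t ∈ T, s t ^ 2 = (∏ j, weierstrassSigma L (γ.abel t - w j)) *
            ∏ j, weierstrassSigma L (γ.abel t + w j)) →
          ∃ B : ℂ, (B = A ∨ B = -A) ∧
            ∀ t ∈ T, f t / g t = B * (s t / weierstrassSigma L (γ.abel t) ^ k)) ∧
    -- the condition which selects the sign of `w j`
    (∀ j, ∀ s v : ℂ, E.IsAbelImage (r j, s) v →
      (s = m j ↔
        K.eval (r j) / ((r j - E.c) ^ 2 * Q.derivative.eval (r j)) =
          Complex.I / ((E.a₁ - E.c) * (E.a₂ - E.c) * (E.a₃ - E.c)) *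
            L.derivWeierstrassP v)) := by
  have hrc : ∀ j, r j ≠ E.c := by
    intro j h
    obtain ⟨h1, h2, -⟩ := hres_pos j
    have h1 : m j ^ 2 = E.U₄ (r j) := h1
    rw [h, QuarticCurve.U₄_c] at h1
    exact h2 (by simpa using h1)
  have hQeval : ∀ x, Q.eval x = r₀ * ∏ j, (x - r j) := by
    intro x
    simp [hQ, eval_prod]
  have hQne : ∀ x, Q.eval x ≠ 0 ↔ ∀ j, x ≠ r j := by
    intro x
    simp [hQeval, hr₀, Finset.prod_eq_zero_iff, sub_eq_zero]
  have hQ' : ∀ j, Q.derivative.eval (r j) ≠ 0 := by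
    intro j
    rw [hQ, eval_derivative_C_mul_prod_X_sub_C]
    exact mul_ne_zero hr₀ (eval_nodal_erase_ne_zero hr j)
  have hKr : ∀ j, K.eval (r j) = 2 * m j * Q.derivative.eval (r j) := by
    intro j
    have := (hres_pos j).eval_eq (by by_contra h; exact (hQne _).1 h j rfl) (hQ' j)
    rwa [one_mul] at this
  have hwr : ∀ j, (L.weierstrassP (w j) = E.shift → w j ∈ L.lattice) ∧ E.lamOf L (w j) = r j ∧
      E.muOf L (w j) = m j := fun j => (hw j).eq_lamOf_muOf hg₂ hg₃
  have hwL : ∀ j, w j ∉ L.lattice := fun j h => hrc j (by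
    rw [← (hwr j).2.1, QuarticCurve.lamOf_of_mem h])
  refine ⟨fun ω => ⟨QuarticCurve.isAbelImage_of_mem_lattice hg₂ hg₃, fun h => ?_⟩,
    fun γ => γ.intervalIntegrable_pullback continuousOn_const, fun γ hγ => ?_, ?_, fun j s v hv => ?_⟩
  · obtain ⟨h1, h2, -⟩ := h.eq_lamOf_muOf hg₂ hg₃
    exact (QuarticCurve.lamOf_eq_c_iff h1).1 h2
  · have hcont : ContinuousOn (fun t => K.eval (γ.lam t) / Q.eval (γ.lam t)) (Icc 0 1) :=
      (K.continuous.comp_continuousOn γ.continuousOn_lam).div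
        (Q.continuous.comp_continuousOn γ.continuousOn_lam) hγ
    exact ⟨γ.intervalIntegrable_pullback (R := fun x => K.eval x / Q.eval x) hcont,
      γ.exists_log_sigma_quotient hg₂ hg₃ hk (R := fun x => K.eval x / Q.eval x) hrc hw
        (fun x hx => eval_div_eval_sub_eq_sum hK hr₀ hr hQ hKr (fun j => (hrc j).symm) hx)
        hcont fun t ht => (hQne _).1 (hγ t ht)⟩
  · obtain ⟨A, hA, h⟩ := QuarticCurve.exists_prod_sub_div_eq_sigma (E := E)
      (fun j => (hwr j).1) hwL
    have key : ∀ γ : E.Path, ∀ t ∈ Icc (0 : ℝ) 1, γ.lam t ≠ E.c →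
        weierstrassSigma L (γ.abel t) ≠ 0 ∧
        (∏ j, (γ.lam t - r j)) / (γ.lam t - E.c) ^ k =
          A ^ 2 * ((∏ j, weierstrassSigma L (γ.abel t - w j)) *
            (∏ j, weierstrassSigma L (γ.abel t + w j)) /
              weierstrassSigma L (γ.abel t) ^ (2 * k)) := by
      intro γ t ht htc
      obtain ⟨h1, h2, -⟩ := γ.eq_lamOf_muOf hg₂ hg₃ ht
      have hL : γ.abel t ∉ L.lattice := fun hL => htc (by rw [h2, QuarticCurve.lamOf_of_mem hL])
      refine ⟨mt L.weierstrassSigma_eq_zero_iff.1 hL, ?_⟩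
      rw [← h _ hL h1, ← h2]
      simp only [fun j => (hwr j).2.1]
    refine ⟨A, hA, fun γ => ⟨key γ, fun T hT hTc hTne f g s hf hg hs hf2 hg2 hs2 => ?_⟩⟩
    have hg0 : ∀ t ∈ T, g t ≠ 0 := fun t ht h0 => by
      have := hg2 t ht
      rw [h0, zero_pow two_ne_zero, eq_comm] at this
      exact (hTne t ht).1 (sub_eq_zero.1 (eq_zero_of_pow_eq_zero this))
    have hf0 : ∀ t ∈ T, f t ≠ 0 := fun t ht h0 => by
      have := hf2 t ht
      rw [h0, zero_pow two_ne_zero] at this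
      exact (hTne t ht).2 (by rw [hQeval, ← this, mul_zero])
    refine exists_sign_of_sq_eq hTc (hf.div hg hg0) (hs.div ?_ ?_) ?_ ?_
    · exact (L.differentiable_weierstrassSigma.continuous.comp_continuousOn
        (γ.continuousOn_abel.mono hT)).pow k
    · exact fun t ht => pow_ne_zero k (key γ t (hT ht) (hTne t ht).1).1
    · intro t ht
      rw [div_pow, hf2 t ht, hg2 t ht, (key γ t (hT ht) (hTne t ht).1).2, mul_pow, div_pow,
        hs2 t ht, ← pow_mul, mul_comm 2 k]
    · exact fun t ht => div_ne_zero (hf0 t ht) (hg0 t ht)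
  · obtain ⟨h1, h2, h3⟩ := hv.eq_lamOf_muOf hg₂ hg₃
    simp only at h2 h3
    have hvL : v ∉ L.lattice := fun h => hrc j (by rw [← h2, QuarticCurve.lamOf_of_mem h])
    have hc : r j - E.c ≠ 0 := sub_ne_zero.2 (hrc j)
    have hQj := hQ' j
    have e1 : K.eval (r j) / ((r j - E.c) ^ 2 * Q.derivative.eval (r j)) =
        2 / (r j - E.c) ^ 2 * m j := by
      rw [hKr]
      field_simp
    have e2 : Complex.I / ((E.a₁ - E.c) * (E.a₂ - E.c) * (E.a₃ - E.c)) *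
        L.derivWeierstrassP v = 2 / (r j - E.c) ^ 2 * s := by
      change Complex.I / E.branchProd * _ = _
      have hB := E.branchProd_ne_zero
      rw [QuarticCurve.derivWeierstrassP_eq h1 hvL, h2, h3]
      field_simp
      linear_combination (-s) * Complex.I_sq
    rw [e1, e2, mul_right_inj' (div_ne_zero two_ne_zero (pow_ne_zero 2 hc)), eq_comm]
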